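/- \textbf{Universality of the output of a single-qubit circuit.} Let $$R_y(t)=\begin{pmatrix}\cos\frac t2&-\sin\frac t2\\ \sin\frac t2&\cos\frac t2\end{pmatrix},\qquad R_z(t)=\begin{pmatrix}e^{it/2}&0\\0&e^{-it/2}\end{pmatrix}.$$ For real parameters $\theta=(\omega,\alpha,\beta,\varphi,\lambda)$ and $x\in\mathbb R$ let $$U^{\mathcal F}(x;\theta)=R_z(\alpha+\beta)R_y(2\lambda)R_z(\alpha-\beta)R_z(2\omega x)R_y(2\varphi),$$ and for $\theta=(\vec\omega,\alpha,\varphi)\in\mathbb R^m\times\mathbb R\times\mathbb R$ and $\vec x\in\mathbb R^m$ ($m\ge 0$) let $$U^{\rm UAT}(\vec x;\theta)=R_y(2\varphi)R_z(2\vec\omega\cdot\vec x+2\alpha).$$ The output of the circuit with layers $\theta_1,\dots,\theta_k$ built from a gate $U$ is the amplitude $\langle 1|U(x;\theta_k)\cdots U(x;\theta_1)|0\rangle$. \textbf{(A) Fourier gates.} Let $P>0$ be a period (for instance $P=1$). (A1) Let a circuit of gates $U^{\mathcal F}$ have frequencies $\omega_i=\pi k_i/P$ with $k_i\in\mathbb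 Z$, $\sum_i k_i$ even and $\sum_i|k_i|\le 2N$. (For instance $N+1$ layers, the first with $\omega=0$ and the others with $\omega=2\pi/P$; or $2N+1$ layers, the first with $\omega=0$ and the others with $\omega=\pi/P$.) Then its output is a truncated Fourier series: there are $B_n\in\mathbb C$, independent of $x$, such that for all $x\in\mathbb R$ the output is $\sum_{n=-N}^{N}B_ne^{2\pi i nx/P}$. (A2) The coefficients are free up to normalization: for every $N\ge 0$ and all $B_{-N},\dots,B_N\in\mathbb C$, the function $\sum_{n=-N}^{N}B_ne^{2\pi inx/P}$ is the output of a circuit of $2N+1$ gates $U^{\mathcal F}$, the first with $\omega=0$ and all others with $\omega=\pi/P$, if and only if its modulus is at most $1$ for every $x\in\mathbb R$. (A3) Let $a,C\in\mathbb R$ and let $z:\mathbb R\to\mathbb C$ satisfy $|z|\le C$ on $[a,a+P)$ and be continuous on $(a,a+P)\setminus D$ with $D$ finite. Then there are, for $N=0,1,2,\dots$, circuits with frequencies as in (A2), with outputs $z_N$ (truncated Fourier series with $|n|\le N$), such that $C z_N(x)\to z(x)$ for every $x\in[a,a+P)$, and the convergence is uniform on every compact subset of $(a,a+P)\setminus D$;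 if $z$ is continuous on $[a,a+P]$ and $z(a)=z(a+P)$, the convergence is uniform on $[a,a+P]$. \textbf{(B) UAT gates.} Let $m\ge 0$. The following holds for circuits built from $U^{\rm UAT}$, and equally for circuits built from the gate with its two rotations exchanged, $R_z(2(\vec\omega\cdot\vec x+\alpha))R_y(2\varphi)$. (B1) For every $N\ge 1$ the output of an $N$-layer circuit is, for all parameters and all $\vec x\in\mathbb R^m$, $$\sum_{j=1}^{2^{N-1}}c_j(\varphi_1,\dots,\varphi_N)\,e^{i\delta_j(\alpha_1,\dots,\alpha_N)}\,e^{i\vec w_j(\vec\omega_1,\dots,\vec\omega_N)\cdot\vec x},$$ where each $c_j$ is $\pm$ a product over $n=1,\dots,N$ of one factor $\sin\varphi_n$ or $\cos\varphi_n$, and $\delta_j=\sum_n s_{j,n}\alpha_n$, $\vec w_j=\sum_n s_{j,n}\vec\omega_n$ with signs $s_{j,n}\in\{1,-1\}$; the signs and the choices between sine and cosine depend only on $N$, $m$ and the gate, not on the parameters or $\vec x$. (B2) Let $C\in\mathbb R$ and let $z:\mathbb R^m\to\mathbb C$ be continuous on $[0,1]^m$ with $|z|\le C$ there. Then there are $N$-layer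 circuits, $N=0,1,2,\dots$, with outputs $z_N$ such that $C z_N\to z$ uniformly on $[0,1]^m$. -/

import Mathlib

open Filter Topology
open scoped Matrix

namespace SingleQubit

noncomputable section

/-- Operators on one qubit, written in the computational basis `|0⟩, |1⟩`. -/
abbrev Op : Type := Matrix (Fin 2) (Fin 2) ℂ

/-- The rotation `R_y(t)`. -/
def Ry (t : ℝ) : Op :=
  !![(Real.cos (t / 2) : ℂ), -(Real.sin (t / 2) : ℂ);
     (Real.sin (t / 2) : ℂ), (Real.cos (t / 2) : ℂ)]

/-- The rotation `R_z(t) = diag(e^{i t / 2}, e^{-i t / 2})`. -/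
def Rz (t : ℝ) : Op :=
  !![Complex.exp (Complex.I * ((t / 2 : ℝ) : ℂ)), 0;
     0, Complex.exp (-(Complex.I * ((t / 2 : ℝ) : ℂ)))]

/-- Parameters `(ω, α, β, φ, λ)` of a Fourier gate. -/
structure FourierParams where
  ω : ℝ
  α : ℝ
  β : ℝ
  φ : ℝ
  lam : ℝ

/-- Parameters `(ω, α, φ)` of a UAT gate acting on `m` variables. -/
structure UATParams (m : ℕ) where
  ω : Fin m → ℝ
  α : ℝ
  φ : ℝ

/-- The Fourier gate
`R_z(α + β) R_y(2λ) R_z(α - β) R_z(2 ω x) R_y(2φ)`. -/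
def fourierGate (x : ℝ) (θ : FourierParams) : Op :=
  Rz (θ.α + θ.β) * Ry (2 * θ.lam) * Rz (θ.α - θ.β) * Rz (2 * θ.ω * x) * Ry (2 * θ.φ)

/-- The UAT gate `R_y(2φ) R_z(2 ω·x + 2α)`. -/
def uatGate {m : ℕ} (x : Fin m → ℝ) (θ : UATParams m) : Op :=
  Ry (2 * θ.φ) * Rz (2 * (θ.ω ⬝ᵥ x) + 2 * θ.α)

/-- The UAT gate with its two rotations in the other order, `R_z(2 (ω·x + α)) R_y(2φ)`. -/
def uatGateZY {m : ℕ} (x : Fin m → ℝ) (θ : UATParams m) : Op :=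
  Rz (2 * (θ.ω ⬝ᵥ x + θ.α)) * Ry (2 * θ.φ)

/-- The circuit `U(x, θ_{k-1}) ⋯ U(x, θ_1) U(x, θ_0)` with `k` layers: the layer `θ_0` acts
first, and each further layer multiplies from the left. -/
def circuit {X Θ : Type*} (U : X → Θ → Op) {k : ℕ} (θ : Fin k → Θ) (x : X) : Op :=
  (List.ofFn fun i => U x (θ i)).reverse.prod

/-- The computational basis state `|b⟩`. -/
def ket (b : Fin 2) : Fin 2 → ℂ := Pi.single b 1

/-- The output amplitude `⟨1| U(x, θ_{k-1}) ⋯ U(x, θ_0) |0⟩`. -/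
def output {X Θ : Type*} (U : X → Θ → Op) {k : ℕ} (θ : Fin k → Θ) (x : X) : ℂ :=
  star (ket 1) ⬝ᵥ (circuit U θ x *ᵥ ket 0)

/-- The truncated Fourier series `∑_{n=-N}^{N} B_n e^{2πi n x / P}` of period `P`. -/
def fourierSum (P : ℝ) (N : ℕ) (B : ℤ → ℂ) (x : ℝ) : ℂ :=
  ∑ n ∈ Finset.Icc (-(N : ℤ)) (N : ℤ),
    B n * Complex.exp (2 * Real.pi * Complex.I * (n : ℂ) * (x : ℂ) / (P : ℂ))

end

end SingleQubit

open SingleQubit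

/-! For Fourier gates, only `R_z(2ωx)` depends on `x`, so each layer multiplies by `e^{±iωx}` and
mixes with constants. The entries are thus trigonometric polynomials, with bounded frequency and
fixed parity (`circuit_mem_trigSpan`).

Conversely, a Fourier sum of degree `N` is `e^{-2πiNx/P} q(e^{2πix/P})` with `q` of degree at most
`2N`. If `|q| ≤ 1` on the circle, Fejér–Riesz (`fejer_riesz`) supplies `p` of degree at most `2N`
with `|p|² + |q|² = 1` there. This identity makes the constant and top coefficient vectors of `(p,
q)` orthogonal, so a constant element of `SU(2)` removes the constant term of one polynomial and the
top term of the other. One `z`-rotation then lowers the degree bound by one; iterating peels off the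
layers (`exists_fourier_circuit`). Density of trigonometric polynomials on the circle, with a slight
shrinking to keep the bound `1`, gives approximation of continuous functions; discontinuities are
handled by a cut-off.

For UAT gates, every gate entry is a single signed term, so expanding the matrix product as a sum
over paths of basis states gives the trigonometric sum.

For UAT density, let `S` be the uniform closure of the circuits on the cube: a closed monoid
containing the constants of `SU(2)`. The functions `h` with `R_z(t h) ∈ S` for all `t` form a vector
space. Feeding `h` into Fourier circuits that approximate `y ↦ e^{ity²/2}` shows that this space is
closed under squares (`rzMap_sq_mem`), hence a subalgebra. It contains the coordinates, so by
Stone–Weierstrass and closedness all `R_z(h)` lie in `S` (`rzMap_mem`). Products of rotations with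
variable angles then realize every amplitude of modulus at most some `r < 1`
(`exists_mem_apply_one_zero_eq`). -/

namespace SingleQubit

open ComplexConjugate

noncomputable section

/-! ### The group `SU(2)` -/

/-- The matrix of determinant `|a|² + |b|²` with first column `(a, b)`. -/
def colMatrix (a b : ℂ) : Op := !![a, -conj b; b, conj a]

theorem colMatrix_mul (a b c d : ℂ) :
    colMatrix a b * colMatrix c d =
      colMatrix (a * c - conj b * d) (b * c + conj a * d) := by
  ext i j
  fin_cases i <;> fin_cases j <;> simp [colMatrix, Matrix.mul_apply, Fin.sum_univ_two] <;> ring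

/-- The special unitary operators on one qubit. -/
def SU2 : Submonoid Op where
  carrier := {M | ∃ a b : ℂ, ‖a‖ ^ 2 + ‖b‖ ^ 2 = 1 ∧ M = colMatrix a b}
  one_mem' := ⟨1, 0, by simp, by
    ext i j; fin_cases i <;> fin_cases j <;> simp [colMatrix]⟩
  mul_mem' := by
    rintro _ _ ⟨a, b, h, rfl⟩ ⟨c, d, h', rfl⟩
    refine ⟨_, _, ?_, colMatrix_mul a b c d⟩
    have e (z : ℂ) : ((‖z‖ ^ 2 : ℝ) : ℂ) = z * conj z := by
      rw [Complex.mul_conj, Complex.normSq_eq_norm_sq]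
    have h1 := congrArg (fun r : ℝ => (r : ℂ)) h
    have h2 := congrArg (fun r : ℝ => (r : ℂ)) h'
    simp only [Complex.ofReal_add, e, Complex.ofReal_one] at h1 h2
    apply Complex.ofReal_injective
    rw [Complex.ofReal_add, e, e, Complex.ofReal_one]
    simp only [map_sub, map_add, map_mul, Complex.conj_conj]
    linear_combination (c * conj c + d * conj d) * h1 + h2

theorem Ry_eq_colMatrix (t : ℝ) :
    Ry t = colMatrix (Real.cos (t / 2) : ℂ) (Real.sin (t / 2) : ℂ) := by
  simp only [Ry, colMatrix, Complex.conj_ofReal]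

theorem Rz_eq_colMatrix (t : ℝ) :
    Rz t = colMatrix (Complex.exp (Complex.I * ((t / 2 : ℝ) : ℂ))) 0 := by
  simp only [Rz, colMatrix, ← Complex.exp_conj, map_mul, Complex.conj_I, Complex.conj_ofReal]
  simp

theorem Ry_mem_SU2 (t : ℝ) : Ry t ∈ SU2 :=
  ⟨_, _, by
    rw [Complex.norm_real, Complex.norm_real, Real.norm_eq_abs, Real.norm_eq_abs, sq_abs, sq_abs,
      Real.cos_sq_add_sin_sq], Ry_eq_colMatrix t⟩

theorem Rz_mem_SU2 (t : ℝ) : Rz t ∈ SU2 :=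
  ⟨_, _, by simp [mul_comm Complex.I, Complex.norm_exp_ofReal_mul_I, -Complex.ofReal_div],
    Rz_eq_colMatrix t⟩

theorem Rz_add (s t : ℝ) : Rz (s + t) = Rz s * Rz t := by
  rw [Rz_eq_colMatrix, Rz_eq_colMatrix, Rz_eq_colMatrix, colMatrix_mul, map_zero, zero_mul,
    sub_zero, zero_mul, mul_zero, add_zero, ← Complex.exp_add, ← mul_add, ← Complex.ofReal_add,
    add_div]

@[simp] theorem Rz_zero : Rz 0 = 1 := by
  ext i j; fin_cases i <;> fin_cases j <;> simp [Rz]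

@[simp] theorem Ry_zero : Ry 0 = 1 := by
  ext i j; fin_cases i <;> fin_cases j <;> simp [Ry]

theorem euler_colMatrix (α β lam : ℝ) :
    Rz (α + β) * Ry (2 * lam) * Rz (α - β) =
      colMatrix (Real.cos lam * Complex.exp (Complex.I * α))
        (Real.sin lam * Complex.exp (-(Complex.I * β))) := by
  rw [Ry_eq_colMatrix, Rz_eq_colMatrix, Rz_eq_colMatrix, colMatrix_mul, colMatrix_mul,
    mul_div_cancel_left₀ _ (two_ne_zero)]
  simp only [← Complex.exp_conj, map_mul, Complex.conj_I, Complex.conj_ofReal, map_zero, zero_mul,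
    mul_zero, sub_zero, zero_add, add_zero]
  congr 1
  · rw [mul_right_comm, ← Complex.exp_add, mul_comm]
    congr 2
    push_cast; ring
  · rw [mul_right_comm, ← Complex.exp_add, mul_comm]
    congr 2
    push_cast; ring

/-- Polar coordinates of the first column: the moduli are a cosine and a sine of one angle, and the
arguments of the two entries are `α` and `-β`. -/
theorem exists_euler {M : Op} (hM : M ∈ SU2) :
    ∃ α β lam : ℝ, Rz (α + β) * Ry (2 * lam) * Rz (α - β) = M := by
  obtain ⟨a, b, h, rfl⟩ := hM
  have hb : Real.sin (Real.arccos ‖a‖) = ‖b‖ := by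
    rw [Real.sin_arccos, ← h, add_sub_cancel_left, Real.sqrt_sq (norm_nonneg _)]
  have ha : Real.cos (Real.arccos ‖a‖) = ‖a‖ :=
    Real.cos_arccos (by linarith [norm_nonneg a]) (by nlinarith [norm_nonneg a, sq_nonneg ‖b‖])
  refine ⟨a.arg, -b.arg, Real.arccos ‖a‖, ?_⟩
  rw [euler_colMatrix, ha, hb, mul_comm Complex.I, Complex.norm_mul_exp_arg_mul_I]
  congr 1
  rw [Complex.ofReal_neg, mul_neg, neg_neg, mul_comm Complex.I, Complex.norm_mul_exp_arg_mul_I]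

theorem norm_sq_col_of_mem_SU2 {M : Op} (hM : M ∈ SU2) : ‖M 0 0‖ ^ 2 + ‖M 1 0‖ ^ 2 = 1 := by
  obtain ⟨a, b, h, rfl⟩ := hM
  simpa [colMatrix] using h

theorem fourierGate_mem_SU2 (x : ℝ) (θ : FourierParams) : fourierGate x θ ∈ SU2 :=
  mul_mem (mul_mem (mul_mem (mul_mem (Rz_mem_SU2 _) (Ry_mem_SU2 _)) (Rz_mem_SU2 _))
    (Rz_mem_SU2 _)) (Ry_mem_SU2 _)

/-! ### Circuits -/

section Circuit

variable {X Θ : Type*} (U : X → Θ → Op)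

theorem output_eq {k : ℕ} (θ : Fin k → Θ) (x : X) : output U θ x = circuit U θ x 1 0 := by
  simp [output, ket]

@[simp] theorem circuit_zero (θ : Fin 0 → Θ) (x : X) : circuit U θ x = 1 := by
  simp [circuit]

theorem circuit_succ {k : ℕ} (θ : Fin (k + 1) → Θ) (x : X) :
    circuit U θ x = U x (θ (Fin.last k)) * circuit U (fun i => θ i.castSucc) x := by
  rw [circuit, List.ofFn_succ']
  simp [circuit, -List.ofFn_succ]

theorem circuit_snoc {k : ℕ} (θ : Fin k → Θ) (t : Θ) (x : X) :
    circuit U (Fin.snoc θ t : Fin (k + 1) → Θ) x = U x t * circuit U θ x := by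
  simp [circuit_succ]

theorem circuit_append {k l : ℕ} (θ : Fin k → Θ) (η : Fin l → Θ) (x : X) :
    circuit U (Fin.append θ η) x = circuit U η x * circuit U θ x := by
  have : (fun i => U x (Fin.append θ η i)) =
      Fin.append (fun i => U x (θ i)) (fun i => U x (η i)) := by
    funext i
    refine Fin.addCases (fun j => ?_) (fun j => ?_) i <;> simp
  rw [circuit, this, List.ofFn_fin_append, List.reverse_append, List.prod_append]
  rfl

theorem circuit_mem {S : Submonoid Op} {k : ℕ} (θ : Fin k → Θ) (x : X)
    (h : ∀ i, U x (θ i) ∈ S) : circuit U θ x ∈ S := by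
  refine Submonoid.list_prod_mem _ fun y hy => ?_
  simp only [List.mem_reverse, List.mem_ofFn] at hy
  obtain ⟨i, rfl⟩ := hy
  exact h i

end Circuit

theorem norm_output_fourierGate_le {k : ℕ} (θ : Fin k → FourierParams) (x : ℝ) :
    ‖output fourierGate θ x‖ ≤ 1 := by
  have h := norm_sq_col_of_mem_SU2
    (circuit_mem fourierGate θ x fun i => fourierGate_mem_SU2 x (θ i))
  rw [output_eq]
  nlinarith [sq_nonneg ‖circuit fourierGate θ x 0 0‖, norm_nonneg (circuit fourierGate θ x 1 0)]

end

end SingleQubit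

namespace SingleQubit

open ComplexConjugate Polynomial

noncomputable section

/-! ### The Fejér–Riesz theorem -/

theorem eq_of_eval_eq_on_circle {p q : ℂ[X]}
    (h : ∀ z : ℂ, ‖z‖ = 1 → p.eval z = q.eval z) : p = q := by
  refine Polynomial.eq_of_infinite_eval_eq p q
    (Set.Infinite.mono (s := Metric.sphere (0 : ℂ) 1) ?_ ?_)
  · intro z hz
    exact h z (by simpa using hz)
  -- The points `e^{in}` are distinct because `π` is irrational.
  · refine Set.infinite_of_injective_forall_mem
      (f := fun n : ℕ => Complex.exp (n * Complex.I)) ?_ ?_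
    · intro m n hmn
      obtain ⟨k, hk⟩ := Complex.exp_eq_exp_iff_exists_int.1 hmn
      have h2 : (m : ℝ) = n + k * (2 * Real.pi) := by
        have := congrArg Complex.im hk
        simpa using this
      by_cases hk0 : k = 0
      · subst hk0; simpa using h2
      · exfalso
        refine irrational_pi.ne_rat (((m : ℤ) - n : ℤ) / (2 * k : ℤ) : ℚ) ?_
        have : (k : ℝ) ≠ 0 := by exact_mod_cast hk0
        push_cast
        field_simp
        linarith
    · intro n
      simpa using Complex.norm_exp_ofReal_mul_I n

/-- The polynomial `z ↦ z ^ M * conj (p (1 / conj z))`. -/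
def conjReflect (M : ℕ) (p : ℂ[X]) : ℂ[X] := (p.map (starRingEnd ℂ)).reflect M

theorem conj_of_norm_one {z : ℂ} (hz : ‖z‖ = 1) : conj z = z⁻¹ := by
  rw [Complex.inv_def, Complex.normSq_eq_norm_sq, hz]; simp

theorem eval_conjReflect_of_ne_zero {M : ℕ} {p : ℂ[X]} (hp : p.natDegree ≤ M) {z : ℂ}
    (hz0 : z ≠ 0) : (conjReflect M p).eval z = z ^ M * conj (p.eval (conj z)⁻¹) := by
  let _ : Invertible (z⁻¹) := invertibleOfNonzero (inv_ne_zero hz0)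
  have h := eval₂_reflect_mul_pow (RingHom.id ℂ) z⁻¹ M (p.map (starRingEnd ℂ))
    (natDegree_map_le.trans hp)
  simp only [invOf_eq_inv, inv_inv] at h
  have h2 : eval₂ (RingHom.id ℂ) z⁻¹ (p.map (starRingEnd ℂ)) = conj (p.eval (conj z)⁻¹) := by
    have : z⁻¹ = conj ((conj z)⁻¹) := by simp
    rw [this, eval₂_id, eval_map, eval₂_hom]
  rw [h2, eval₂_id] at h
  rw [← h, inv_pow, conjReflect]
  field_simp

theorem eval_conjReflect {M : ℕ} {p : ℂ[X]} (hp : p.natDegree ≤ M) {z : ℂ} (hz : ‖z‖ = 1) :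
    (conjReflect M p).eval z = z ^ M * conj (p.eval z) := by
  have hz0 : z ≠ 0 := by rintro rfl; simp at hz
  rw [eval_conjReflect_of_ne_zero hp hz0, conj_of_norm_one hz, inv_inv]

theorem coeff_conjReflect {M k : ℕ} (p : ℂ[X]) (hk : k ≤ M) :
    (conjReflect M p).coeff k = conj (p.coeff (M - k)) := by
  rw [conjReflect, coeff_reflect, revAt_le hk, coeff_map]

theorem natDegree_conjReflect_le {M : ℕ} {p : ℂ[X]} (hp : p.natDegree ≤ M) :
    (conjReflect M p).natDegree ≤ M := by
  refine (natDegree_reflect_le).trans ?_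
  exact max_le le_rfl (natDegree_map_le.trans hp)

/-- A zero on the unit circle of a nonnegative trigonometric polynomial is a multiple zero. -/
theorem eval_eq_zero_of_nonneg_of_linear_factor {M : ℕ} {a : ℂ} (ha : ‖a‖ = 1) {Q : ℂ[X]}
    {r : ℂ → ℝ} (hr : ∀ z : ℂ, ‖z‖ = 1 → 0 ≤ r z)
    (h : ∀ z : ℂ, ‖z‖ = 1 → (z - a) * Q.eval z = z ^ M * r z) : Q.eval a = 0 := by
  set e : ℝ → ℂ := fun t => a * Complex.exp (t * Complex.I) with he
  have hen (t) : ‖e t‖ = 1 := by simp [he, ha, Complex.norm_exp_ofReal_mul_I]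
  have hen0 (t) : e t ≠ 0 := fun h => by simpa [h] using hen t
  have hd : HasDerivAt e (a * Complex.I) 0 := by
    have h1 : HasDerivAt (fun t : ℝ => Complex.exp (t * Complex.I))
        (Complex.exp ((0 : ℝ) * Complex.I) * (1 * Complex.I)) 0 :=
      (Complex.ofRealCLM.hasDerivAt.mul_const Complex.I).cexp
    simpa using h1.const_mul a
  have he0 : e 0 = a := by simp [he]
  -- `F` is `r` along the circle through `a`. It is real, nonnegative and zero at `t = 0`, so both
  -- parts of its derivative vanish there; that derivative is a nonzero multiple of `Q.eval a`.
  set F : ℝ → ℂ := fun t => (e t - a) * (Q.eval (e t) * (e t)⁻¹ ^ M) with hF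
  have hFr (t) : F t = (r (e t) : ℂ) := by
    have := h _ (hen t)
    rw [hF]
    simp only
    rw [← mul_assoc, this, inv_pow]
    field_simp [hen0 t]
  have hFd : HasDerivAt F (a * Complex.I * (Q.eval a * a⁻¹ ^ M)) 0 := by
    have hq : DifferentiableAt ℝ (fun t => Q.eval (e t) * (e t)⁻¹ ^ M) 0 := by
      refine DifferentiableAt.mul ?_ ?_
      · exact ((Q.differentiable (e 0)).restrictScalars ℝ).comp (0 : ℝ) hd.differentiableAt
      · exact (hd.differentiableAt.inv (hen0 0)).pow _
    have := (hd.sub_const a).mul hq.hasDerivAt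
    convert! this using 1
    simp [he0]
  have hre : HasDerivAt (fun t => r (e t)) ((a * Complex.I * (Q.eval a * a⁻¹ ^ M)).re) 0 := by
    have h1 := (Complex.reCLM.hasFDerivAt.comp_hasDerivAt (0 : ℝ) hFd)
    refine h1.congr_of_eventuallyEq (Eventually.of_forall fun t => ?_)
    simp [hFr]
  have him : HasDerivAt (fun _ : ℝ => (0 : ℝ)) ((a * Complex.I * (Q.eval a * a⁻¹ ^ M)).im) 0 := by
    have h1 := (Complex.imCLM.hasFDerivAt.comp_hasDerivAt (0 : ℝ) hFd)
    refine h1.congr_of_eventuallyEq (Eventually.of_forall fun t => ?_)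
    simp [hFr]
  have hmin : IsLocalMin (fun t => r (e t)) 0 := by
    refine Eventually.of_forall fun t => ?_
    have h0 : r (e 0) = 0 := by
      have := hFr 0
      simp only [hF, he0, sub_self, zero_mul] at this
      rw [he0]; exact_mod_cast this.symm
    simp only [h0]
    exact hr _ (hen t)
  have hz : a * Complex.I * (Q.eval a * a⁻¹ ^ M) = 0 :=
    Complex.ext (hmin.hasDerivAt_eq_zero hre) (him.unique (hasDerivAt_const _ _))
  have ha0 : a ≠ 0 := by rintro rfl; simp at ha
  simpa [ha0] using hz

/-- Reality of `r` makes `p` equal to its conjugate reflection, so its nonzero roots come in pairs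
`a`, `1 / conj a`; on the circle the pair degenerates to a multiple root because `r ≥ 0`. Each pair
contributes a factor `‖z - a‖²` to `r`, which is split off by induction on `M`. -/
theorem fejer_riesz (M : ℕ) (p : ℂ[X]) (hp : p.natDegree ≤ 2 * M) (r : ℂ → ℝ)
    (hr : ∀ z : ℂ, ‖z‖ = 1 → 0 ≤ r z) (h : ∀ z : ℂ, ‖z‖ = 1 → p.eval z = z ^ M * r z) :
    ∃ q : ℂ[X], q.natDegree ≤ M ∧ ∀ z : ℂ, ‖z‖ = 1 → r z = ‖q.eval z‖ ^ 2 := by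
  induction M generalizing p r with
  | zero =>
    have hc := eq_C_of_natDegree_le_zero (by simpa using hp)
    have h1 (z : ℂ) (hz : ‖z‖ = 1) : (r z : ℂ) = p.coeff 0 := by
      have := h z hz
      rw [hc] at this
      simpa using this.symm
    refine ⟨C (Real.sqrt (r 1) : ℂ), by simp, fun z hz => ?_⟩
    have h2 : r z = r 1 := by
      apply Complex.ofReal_injective
      rw [h1 z hz, h1 1 (by simp)]
    rw [eval_C, Complex.norm_real, Real.norm_eq_abs, sq_abs, Real.sq_sqrt (hr 1 (by simp)), h2]
  | succ M ih =>
    have hself : conjReflect (2 * (M + 1)) p = p := by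
      refine eq_of_eval_eq_on_circle fun z hz => ?_
      have hz0 : z ≠ 0 := by rintro rfl; simp at hz
      rw [eval_conjReflect hp hz, h z hz, map_mul, map_pow, conj_of_norm_one hz,
        Complex.conj_ofReal, inv_pow]
      field_simp
      ring
    by_cases h0 : p.coeff 0 = 0
    -- By self-reflection the top coefficient vanishes too, so dividing by `X` brings the degree
    -- bound from `2(M + 1)` down to `2M`.
    · obtain ⟨s, hs⟩ := X_dvd_iff.2 h0
      have htop : p.coeff (2 * (M + 1)) = 0 := by
        have := coeff_conjReflect (M := 2 * (M + 1)) p le_rfl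
        rw [hself] at this
        simpa [h0] using this
      have hsd : s.natDegree ≤ 2 * M := by
        refine natDegree_le_iff_coeff_eq_zero.2 fun n hn => ?_
        rw [← coeff_X_mul, ← hs]
        rcases eq_or_lt_of_le (show 2 * (M + 1) ≤ n + 1 by omega) with h1 | h1
        · rw [← h1, htop]
        · exact coeff_eq_zero_of_natDegree_lt (hp.trans_lt h1)
      obtain ⟨q, hq, hqr⟩ := ih s hsd r hr fun z hz => by
        have hz0 : z ≠ 0 := by rintro rfl; simp at hz
        have := h z hz
        rw [hs, eval_mul, eval_X, pow_succ'] at this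
        exact mul_left_cancel₀ hz0 (by linear_combination this)
      exact ⟨q, hq.trans (Nat.le_succ _), hqr⟩
    · have hdeg : p.natDegree = 2 * (M + 1) := by
        refine le_antisymm hp (le_natDegree_of_ne_zero ?_)
        have := coeff_conjReflect (M := 2 * (M + 1)) p le_rfl
        rw [hself] at this
        rw [this]
        simpa using h0
      obtain ⟨a, ha⟩ := IsAlgClosed.exists_root p (by
        rw [Polynomial.degree_eq_natDegree (by rintro rfl; simp at h0), hdeg]
        norm_cast
        )
      have ha0 : a ≠ 0 := by
        rintro rfl
        exact h0 (by rw [coeff_zero_eq_eval_zero]; exact ha)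
      obtain ⟨Q, hQ⟩ := dvd_iff_isRoot.2 ha
      have hQroot : Q.eval (conj a)⁻¹ = 0 := by
        by_cases hna : ‖a‖ = 1
        · rw [conj_of_norm_one hna, inv_inv]
          refine eval_eq_zero_of_nonneg_of_linear_factor hna hr (M := M + 1) fun z hz => ?_
          rw [← h z hz, hQ]; simp
        · have h1 : p.eval (conj a)⁻¹ = 0 := by
            have := eval_conjReflect_of_ne_zero hp (z := (conj a)⁻¹) (by simpa using ha0)
            rw [hself] at this
            rw [this, map_inv₀, Complex.conj_conj, inv_inv, ha.eq_zero, map_zero, mul_zero]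
          rw [hQ, eval_mul] at h1
          refine (mul_eq_zero.1 h1).resolve_left fun h2 => hna ?_
          have h3 : (conj a)⁻¹ = a := by simpa [sub_eq_zero] using h2
          have h4 : a * conj a = 1 := by
            nth_rewrite 1 [← h3]
            exact inv_mul_cancel₀ (by simpa using ha0)
          rw [Complex.mul_conj, Complex.normSq_eq_norm_sq] at h4
          have h5 : ‖a‖ ^ 2 = 1 := by exact_mod_cast h4
          exact (pow_eq_one_iff_of_nonneg (norm_nonneg a) two_ne_zero).1 h5
      obtain ⟨s, hs⟩ := dvd_iff_isRoot.2 hQroot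
      have hca0 : conj a ≠ 0 := by simpa using ha0
      have hs0 : s ≠ 0 := by
        rintro rfl
        simp [hQ, hs] at h0
      -- The constant comes from `z ‖z - a‖² = -conj a (z - a)(z - 1 / conj a)` on the circle.
      set t : ℂ[X] := C (-(conj a)⁻¹) * s with ht
      have htd : t.natDegree ≤ 2 * M := by
        refine (natDegree_C_mul_le _ _).trans ?_
        rw [hQ, hs, natDegree_mul (X_sub_C_ne_zero _) (mul_ne_zero (X_sub_C_ne_zero _) hs0),
          natDegree_mul (X_sub_C_ne_zero _) hs0, natDegree_X_sub_C, natDegree_X_sub_C] at hdeg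
        omega
      have key (z : ℂ) (hz : ‖z‖ = 1) : (‖z - a‖ ^ 2 : ℝ) * t.eval z = z ^ M * r z := by
        have hz0 : z ≠ 0 := by rintro rfl; simp at hz
        have h1 := h z hz
        rw [hQ, hs] at h1
        simp only [eval_mul, eval_sub, eval_X, eval_C] at h1
        rw [← Complex.normSq_eq_norm_sq, ← Complex.mul_conj, map_sub, conj_of_norm_one hz, ht,
          eval_mul, eval_C]
        apply mul_left_cancel₀ hz0
        rw [show z * (z ^ M * (r z : ℂ)) = z ^ (M + 1) * r z by ring, ← h1]
        field_simp
        ring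
      -- Away from `a` this follows by dividing by `‖z - a‖²`; it extends to `z = a` because the
      -- nonnegative reals are closed and `a` is approached along the circle.
      have hreal (z : ℂ) (hz : ‖z‖ = 1) :
          z⁻¹ ^ M * t.eval z ∈ {w : ℂ | 0 ≤ w.re ∧ w.im = 0} := by
        have hne (z : ℂ) (hz : ‖z‖ = 1) (hza : z ≠ a) :
            z⁻¹ ^ M * t.eval z ∈ {w : ℂ | 0 ≤ w.re ∧ w.im = 0} := by
          have hz0 : z ≠ 0 := by rintro rfl; simp at hz
          have hza' : ((‖z - a‖ ^ 2 : ℝ) : ℂ) ≠ 0 := by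
            exact_mod_cast pow_ne_zero 2 (norm_ne_zero_iff.2 (sub_ne_zero.2 hza))
          have : z⁻¹ ^ M * t.eval z = ((r z / ‖z - a‖ ^ 2 : ℝ) : ℂ) := by
            rw [Complex.ofReal_div, eq_div_iff hza', mul_assoc, mul_comm (t.eval z), key z hz,
              inv_pow]
            field_simp
          rw [this]
          exact ⟨by simpa only [Complex.ofReal_re] using div_nonneg (hr z hz) (sq_nonneg ‖z - a‖),
            Complex.ofReal_im _⟩
        have hz0 : z ≠ 0 := by rintro rfl; simp at hz
        set e : ℝ → ℂ := fun t => z * Complex.exp (t * Complex.I) with he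
        have hen (t) : ‖e t‖ = 1 := by simp [he, hz, Complex.norm_exp_ofReal_mul_I]
        have he0 : e 0 = z := by simp [he]
        have hd : HasDerivAt e (z * Complex.I) 0 := by
          have h1 : HasDerivAt (fun t : ℝ => Complex.exp (t * Complex.I))
              (Complex.exp ((0 : ℝ) * Complex.I) * (1 * Complex.I)) 0 :=
            (Complex.ofRealCLM.hasDerivAt.mul_const Complex.I).cexp
          simpa using h1.const_mul z
        have hclosed : IsClosed {w : ℂ | 0 ≤ w.re ∧ w.im = 0} :=
          (isClosed_le continuous_const Complex.continuous_re).inter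
            (isClosed_eq Complex.continuous_im continuous_const)
        have hc : ContinuousAt (fun u => (e u)⁻¹ ^ M * t.eval (e u)) 0 :=
          ((hd.continuousAt.inv₀ (by simpa [he0] using hz0)).pow M).mul
            (t.continuous.continuousAt.comp hd.continuousAt)
        have hev := hd.eventually_ne (c := a) (mul_ne_zero hz0 Complex.I_ne_zero)
        have := hclosed.mem_of_tendsto (hc.tendsto.mono_left nhdsWithin_le_nhds)
          (hev.mono fun u hu => hne (e u) (hen u) hu)
        simpa only [he0] using this
      have hr' (z : ℂ) (hz : ‖z‖ = 1) : t.eval z = z ^ M * ((z⁻¹ ^ M * t.eval z).re : ℂ) := by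
        have hz0 : z ≠ 0 := by rintro rfl; simp at hz
        have : ((z⁻¹ ^ M * t.eval z).re : ℂ) = z⁻¹ ^ M * t.eval z :=
          Complex.ext (Complex.ofReal_re _) ((Complex.ofReal_im _).trans (hreal z hz).2.symm)
        rw [this, inv_pow]
        field_simp
      obtain ⟨q, hq, hqr⟩ := ih t htd (fun z => (z⁻¹ ^ M * t.eval z).re)
        (fun z hz => (hreal z hz).1) hr'
      refine ⟨(X - C a) * q, ?_, fun z hz => ?_⟩
      · refine natDegree_mul_le.trans ?_
        rw [natDegree_X_sub_C]
        omega
      · have hz0 : z ≠ 0 := by rintro rfl; simp at hz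
        have h1 := key z hz
        rw [hr' z hz, hqr z hz] at h1
        have h2 := mul_left_cancel₀ (pow_ne_zero M hz0)
          (show z ^ M * ((‖z - a‖ ^ 2 * ‖q.eval z‖ ^ 2 : ℝ) : ℂ) = z ^ M * r z by
            rw [← h1]; push_cast; ring)
        rw [eval_mul, norm_mul, mul_pow]
        simpa using (Complex.ofReal_injective h2).symm

end

end SingleQubit

namespace SingleQubit

open ComplexConjugate Polynomial

noncomputable section

/-! ### Synthesis of Fourier circuits -/

/-- Normalization on the circle is the polynomial identity `p p* + q q* = X^M`, with `*` the
conjugate reflection; compare constant coefficients. -/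
theorem coeff_orthogonal {M : ℕ} (hM : M ≠ 0) {p q : ℂ[X]} (hp : p.natDegree ≤ M)
    (hq : q.natDegree ≤ M)
    (h : ∀ z : ℂ, ‖z‖ = 1 → ‖p.eval z‖ ^ 2 + ‖q.eval z‖ ^ 2 = 1) :
    p.coeff 0 * conj (p.coeff M) + q.coeff 0 * conj (q.coeff M) = 0 := by
  have h1 : p * conjReflect M p + q * conjReflect M q = X ^ M := by
    refine eq_of_eval_eq_on_circle fun z hz => ?_
    rw [eval_add, eval_mul, eval_mul, eval_conjReflect hp hz, eval_conjReflect hq hz, eval_pow,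
      eval_X]
    have h2 := congrArg (fun r : ℝ => (r : ℂ)) (h z hz)
    simp only [Complex.ofReal_add, ← Complex.normSq_eq_norm_sq, ← Complex.mul_conj,
      Complex.ofReal_one] at h2
    linear_combination z ^ M * h2
  have h2 := congrArg (fun f : ℂ[X] => f.coeff 0) h1
  simpa [mul_coeff_zero, coeff_conjReflect, coeff_X_pow, hM.symm] using h2

/-- In `ℂ²` a unit vector orthogonal to `(p₀, q₀)` and parallel to `(p₁, q₁)` is wanted. The plane
has dimension two, so whichever vector is nonzero determines the line, and orthogonality makes the
other condition automatic. -/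
theorem exists_unit_vector_orthogonal {p₀ q₀ p₁ q₁ : ℂ} (h : p₀ * conj p₁ + q₀ * conj q₁ = 0) :
    ∃ a b : ℂ, ‖a‖ ^ 2 + ‖b‖ ^ 2 = 1 ∧ conj a * p₀ + conj b * q₀ = 0 ∧ a * q₁ - b * p₁ = 0 := by
  have scale {a b : ℂ} (hab : ‖a‖ ^ 2 + ‖b‖ ^ 2 ≠ 0) (h0 : conj a * p₀ + conj b * q₀ = 0)
      (h1 : a * q₁ - b * p₁ = 0) :
      ∃ a b : ℂ, ‖a‖ ^ 2 + ‖b‖ ^ 2 = 1 ∧ conj a * p₀ + conj b * q₀ = 0 ∧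
        a * q₁ - b * p₁ = 0 := by
    have hpos : 0 < ‖a‖ ^ 2 + ‖b‖ ^ 2 := lt_of_le_of_ne (by positivity) hab.symm
    set r : ℝ := (Real.sqrt (‖a‖ ^ 2 + ‖b‖ ^ 2))⁻¹ with hr
    have hr2 : r ^ 2 * (‖a‖ ^ 2 + ‖b‖ ^ 2) = 1 := by
      rw [hr, inv_pow, Real.sq_sqrt hpos.le, inv_mul_cancel₀ hab]
    refine ⟨r * a, r * b, ?_, ?_, ?_⟩
    · rw [norm_mul, norm_mul, Complex.norm_real, Real.norm_eq_abs, mul_pow, mul_pow, sq_abs]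
      linarith
    · simp only [map_mul, Complex.conj_ofReal]
      linear_combination (r : ℂ) * h0
    · linear_combination (r : ℂ) * h1
  by_cases h0 : ‖q₀‖ ^ 2 + ‖p₀‖ ^ 2 = 0
  · have hq : q₀ = 0 := by
      rw [← norm_eq_zero]; nlinarith [sq_nonneg ‖q₀‖, sq_nonneg ‖p₀‖]
    have hp : p₀ = 0 := by
      rw [← norm_eq_zero]; nlinarith [sq_nonneg ‖q₀‖, sq_nonneg ‖p₀‖]
    by_cases h1 : ‖p₁‖ ^ 2 + ‖q₁‖ ^ 2 = 0
    · have hq1 : q₁ = 0 := by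
        rw [← norm_eq_zero]; nlinarith [sq_nonneg ‖q₁‖, sq_nonneg ‖p₁‖]
      have hp1 : p₁ = 0 := by
        rw [← norm_eq_zero]; nlinarith [sq_nonneg ‖q₁‖, sq_nonneg ‖p₁‖]
      exact ⟨1, 0, by simp, by simp [hp], by simp [hq1]⟩
    · exact scale h1 (by simp [hp, hq]) (by ring)
  · refine scale (a := conj q₀) (b := -conj p₀) (by simpa using h0) ?_ ?_
    · simp only [Complex.conj_conj, map_neg]; ring
    · have := congrArg conj h
      simp only [map_add, map_mul, Complex.conj_conj, map_zero] at this
      linear_combination this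

/-- The Euler angles alone produce every constant, so the last rotation can be switched off with `φ
= 0`. -/
theorem fourierGate_euler {M : Op} (hM : M ∈ SU2) (ω : ℝ) :
    ∃ θ : FourierParams, θ.ω = ω ∧ ∀ x, fourierGate x θ = M * Rz (2 * ω * x) := by
  obtain ⟨α, β, lam, h⟩ := exists_euler hM
  refine ⟨⟨ω, α, β, 0, lam⟩, rfl, fun x => ?_⟩
  simp only [fourierGate, h, mul_zero, Ry_zero, mul_one]

/-- The point `e^{2πi x / P}` of the unit circle. -/
def circlePoint (P x : ℝ) : ℂ := Complex.exp ((2 * Real.pi * x / P : ℝ) * Complex.I)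

theorem circlePoint_ne_zero (P x : ℝ) : circlePoint P x ≠ 0 := Complex.exp_ne_zero _

theorem exists_circlePoint {P : ℝ} (hP : P ≠ 0) {z : ℂ} (hz : ‖z‖ = 1) :
    ∃ x, circlePoint P x = z := by
  refine ⟨P * z.arg / (2 * Real.pi), ?_⟩
  have : 2 * Real.pi * (P * z.arg / (2 * Real.pi)) / P = z.arg := by
    field_simp
  rw [circlePoint, this]
  simpa [hz] using Complex.norm_mul_exp_arg_mul_I z

/-- Any pair of polynomials of degree at most `M` which is normalized on the unit circle is, up to
the shift by `e^{-iπMx/P}`, the state prepared by a circuit of `M + 1` Fourier gates. -/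
theorem exists_fourier_circuit (P : ℝ) (M : ℕ) (p q : ℂ[X]) (hp : p.natDegree ≤ M)
    (hq : q.natDegree ≤ M)
    (h : ∀ z : ℂ, ‖z‖ = 1 → ‖p.eval z‖ ^ 2 + ‖q.eval z‖ ^ 2 = 1) :
    ∃ θ : Fin (M + 1) → FourierParams, (θ 0).ω = 0 ∧ (∀ i, i ≠ 0 → (θ i).ω = Real.pi / P) ∧
      ∀ x : ℝ,
        circuit fourierGate θ x 0 0 =
          Complex.exp (-((M * (Real.pi * x / P) : ℝ) * Complex.I)) * p.eval (circlePoint P x) ∧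
        circuit fourierGate θ x 1 0 =
          Complex.exp (-((M * (Real.pi * x / P) : ℝ) * Complex.I)) * q.eval (circlePoint P x) := by
  induction M generalizing p q with
  | zero =>
    have hpc := eq_C_of_natDegree_le_zero hp
    have hqc := eq_C_of_natDegree_le_zero hq
    have h1 := h 1 (by simp)
    rw [hpc, hqc, eval_C, eval_C] at h1
    obtain ⟨θ, hω, hθ⟩ :=
      fourierGate_euler (M := colMatrix (p.coeff 0) (q.coeff 0)) ⟨_, _, h1, rfl⟩ 0
    refine ⟨fun _ => θ, hω, fun i hi => absurd (Fin.fin_one_eq_zero i) hi, fun x => ?_⟩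
    rw [circuit_succ, circuit_zero, hθ, hpc, hqc, mul_one, mul_zero, zero_mul, Rz_zero, mul_one]
    simp [colMatrix]
  | succ M ih =>
    obtain ⟨a, b, hab, h0, h1⟩ :=
      exists_unit_vector_orthogonal (coeff_orthogonal M.succ_ne_zero hp hq h)
    have hab' : a * conj a + b * conj b = 1 := by
      rw [Complex.mul_conj, Complex.mul_conj, Complex.normSq_eq_norm_sq, Complex.normSq_eq_norm_sq]
      exact_mod_cast hab
    -- `(p₁, q₁)` is `(colMatrix a b)⁻¹` applied to `(p, q)`. By the choice of `(a, b)`, `p₁` has no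
    -- constant term and `q₁` no term of degree `M + 1`.
    set p₁ : ℂ[X] := C (conj a) * p + C (conj b) * q with hp₁
    set q₁ : ℂ[X] := C a * q - C b * p with hq₁
    have hpb : p = C a * p₁ - C (conj b) * q₁ := by
      have : (C (a * conj a + b * conj b) : ℂ[X]) = 1 := by rw [hab', C_1]
      rw [C_add, C_mul, C_mul] at this
      rw [hp₁, hq₁]
      linear_combination (-p) * this
    have hqb : q = C b * p₁ + C (conj a) * q₁ := by
      have : (C (a * conj a + b * conj b) : ℂ[X]) = 1 := by rw [hab', C_1]
      rw [C_add, C_mul, C_mul] at this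
      rw [hp₁, hq₁]
      linear_combination (-q) * this
    obtain ⟨p₂, hp₂⟩ : X ∣ p₁ := X_dvd_iff.2 (by simpa [hp₁] using h0)
    have hp₁d : p₁.natDegree ≤ M + 1 :=
      natDegree_add_le_of_degree_le ((natDegree_C_mul_le _ _).trans hp)
        ((natDegree_C_mul_le _ _).trans hq)
    have hq₁d : q₁.natDegree ≤ M + 1 :=
      (natDegree_sub_le_of_le ((natDegree_C_mul_le _ _).trans hq)
        ((natDegree_C_mul_le _ _).trans hp)).trans (max_self _).le
    have hp₂d : p₂.natDegree ≤ M := by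
      refine natDegree_le_iff_coeff_eq_zero.2 fun n hn => ?_
      rw [← coeff_X_mul, ← hp₂]
      exact coeff_eq_zero_of_natDegree_lt (hp₁d.trans_lt (by omega))
    have hq₁d' : q₁.natDegree ≤ M := by
      refine natDegree_le_iff_coeff_eq_zero.2 fun n hn => ?_
      rcases eq_or_lt_of_le (Nat.succ_le_of_lt hn) with h2 | h2
      · rw [← h2]; simpa [hq₁] using h1
      · exact coeff_eq_zero_of_natDegree_lt (hq₁d.trans_lt h2)
    obtain ⟨θ, hθ0, hθ1, hθ⟩ := ih p₂ q₁ hp₂d hq₁d' fun z hz => by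
      have hpp : ‖p₂.eval z‖ = ‖conj a * p.eval z + conj b * q.eval z‖ := by
        have : conj a * p.eval z + conj b * q.eval z = z * p₂.eval z := by
          have := congrArg (eval z) hp₂
          simpa [hp₁] using this
        rw [this, norm_mul, hz, one_mul]
      have hqq : q₁.eval z = a * q.eval z - b * p.eval z := by simp [hq₁]
      rw [hpp, hqq, ← h z hz]
      apply Complex.ofReal_injective
      simp only [Complex.ofReal_add, ← Complex.normSq_eq_norm_sq, ← Complex.mul_conj]
      simp only [map_add, map_sub, map_mul, Complex.conj_conj]
      linear_combination (p.eval z * conj (p.eval z) + q.eval z * conj (q.eval z)) * hab'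
    obtain ⟨t, htω, ht⟩ := fourierGate_euler (M := colMatrix a b) ⟨_, _, hab, rfl⟩ (Real.pi / P)
    refine ⟨Fin.snoc θ t, ?_, ?_, fun x => ?_⟩
    · rw [← Fin.castSucc_zero, Fin.snoc_castSucc, hθ0]
    · intro i
      refine Fin.lastCases (fun _ => ?_) (fun j hj => ?_) i
      · rw [Fin.snoc_last, htω]
      · rw [Fin.snoc_castSucc]
        exact hθ1 j fun hj0 => hj (by rw [hj0, Fin.castSucc_zero])
    · obtain ⟨e0, e1⟩ := hθ x
      have hz := circlePoint_ne_zero P x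
      -- The phases `e^{±iπx/P}` of the new layer are `e^{-iπx/P}` times `circlePoint P x` and `1`:
      -- the first restores the factor `X` of `p₁`, the second leaves `q₁` alone.
      have hexp : Complex.exp (-(((M : ℕ) * (Real.pi * x / P) : ℝ) * Complex.I)) *
          Complex.exp (Complex.I * ((2 * (Real.pi / P) * x / 2 : ℝ) : ℂ)) =
          Complex.exp (-((((M + 1 : ℕ) : ℝ) * (Real.pi * x / P) : ℝ) * Complex.I)) *
            circlePoint P x := by
        rw [circlePoint, ← Complex.exp_add, ← Complex.exp_add]
        congr 1
        push_cast
        ring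
      have hexp' : Complex.exp (-(((M : ℕ) * (Real.pi * x / P) : ℝ) * Complex.I)) *
          Complex.exp (-(Complex.I * ((2 * (Real.pi / P) * x / 2 : ℝ) : ℂ))) =
          Complex.exp (-((((M + 1 : ℕ) : ℝ) * (Real.pi * x / P) : ℝ) * Complex.I)) := by
        rw [← Complex.exp_add]
        congr 1
        push_cast
        ring
      have ep : p.eval (circlePoint P x) = a * (circlePoint P x * p₂.eval (circlePoint P x)) -
          conj b * q₁.eval (circlePoint P x) := by
        have := congrArg (eval (circlePoint P x)) hpb
        rw [hp₂] at this
        simpa using this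
      have eq : q.eval (circlePoint P x) = b * (circlePoint P x * p₂.eval (circlePoint P x)) +
          conj a * q₁.eval (circlePoint P x) := by
        have := congrArg (eval (circlePoint P x)) hqb
        rw [hp₂] at this
        simpa using this
      have hentry (i : Fin 2) : circuit fourierGate (Fin.snoc θ t : Fin (M + 2) → _) x i 0 =
          colMatrix a b i 0 * Complex.exp (Complex.I * ((2 * (Real.pi / P) * x / 2 : ℝ) : ℂ)) *
            circuit fourierGate θ x 0 0 +
          colMatrix a b i 1 * Complex.exp (-(Complex.I * ((2 * (Real.pi / P) * x / 2 : ℝ) : ℂ))) *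
            circuit fourierGate θ x 1 0 := by
        rw [circuit_snoc, ht, Matrix.mul_apply, Fin.sum_univ_two, Matrix.mul_apply,
          Matrix.mul_apply, Fin.sum_univ_two, Fin.sum_univ_two]
        simp [Rz]
      constructor
      · rw [hentry, e0, e1, ep]
        simp only [colMatrix, Matrix.of_apply, Matrix.cons_val', Matrix.cons_val_zero,
          Matrix.cons_val_one, Matrix.cons_val_fin_one]
        linear_combination a * p₂.eval (circlePoint P x) * hexp -
          conj b * q₁.eval (circlePoint P x) * hexp'
      · rw [hentry, e0, e1, eq]
        simp only [colMatrix, Matrix.of_apply, Matrix.cons_val', Matrix.cons_val_zero,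
          Matrix.cons_val_one, Matrix.cons_val_fin_one]
        linear_combination b * p₂.eval (circlePoint P x) * hexp +
          conj a * q₁.eval (circlePoint P x) * hexp'

/-- The polynomial `∑ B_n X ^ (n + N)`. -/
def shiftedPolynomial (N : ℕ) (B : ℤ → ℂ) : ℂ[X] :=
  ∑ k ∈ Finset.range (2 * N + 1), C (B ((k : ℤ) - N)) * X ^ k

theorem natDegree_shiftedPolynomial_le (N : ℕ) (B : ℤ → ℂ) :
    (shiftedPolynomial N B).natDegree ≤ 2 * N := by
  refine natDegree_sum_le_of_forall_le _ _ fun k hk => ?_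
  exact (natDegree_C_mul_X_pow_le _ _).trans (by have := Finset.mem_range.1 hk; omega)

theorem fourierSum_eq (P : ℝ) (N : ℕ) (B : ℤ → ℂ) (x : ℝ) :
    fourierSum P N B x = Complex.exp (-(((2 * N : ℕ) * (Real.pi * x / P) : ℝ) * Complex.I)) *
      (shiftedPolynomial N B).eval (circlePoint P x) := by
  rw [shiftedPolynomial, eval_finsetSum, Finset.mul_sum, fourierSum]
  symm
  refine Finset.sum_bij (fun k _ => (k : ℤ) - N) ?_ ?_ ?_ ?_
  · intro k hk
    have := Finset.mem_range.1 hk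
    rw [Finset.mem_Icc]
    omega
  · intro k _ l _ hkl
    omega
  · intro n hn
    rw [Finset.mem_Icc] at hn
    refine ⟨(n + N).toNat, Finset.mem_range.2 (by omega), by omega⟩
  · intro k _
    rw [eval_mul, eval_C, eval_pow, eval_X, circlePoint, ← Complex.exp_nat_mul, mul_left_comm,
      ← Complex.exp_add]
    congr 2
    push_cast
    ring

/-- Necessity is unitarity. For sufficiency, Fejér–Riesz applied to `1 - |q|²` yields the other
component of a normalized state. -/
theorem exists_output_eq_fourierSum_iff {P : ℝ} (hP : 0 < P) (N : ℕ) (B : ℤ → ℂ) :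
    (∃ θ : Fin (2 * N + 1) → FourierParams,
      (θ 0).ω = 0 ∧ (∀ i, i ≠ 0 → (θ i).ω = Real.pi / P) ∧
      ∀ x : ℝ, output fourierGate θ x = fourierSum P N B x) ↔
    ∀ x : ℝ, ‖fourierSum P N B x‖ ≤ 1 := by
  constructor
  · rintro ⟨θ, -, -, h⟩ x
    rw [← h]
    exact norm_output_fourierGate_le θ x
  · intro h
    set q := shiftedPolynomial N B with hq
    have hqd : q.natDegree ≤ 2 * N := natDegree_shiftedPolynomial_le N B
    have hq1 (z : ℂ) (hz : ‖z‖ = 1) : ‖q.eval z‖ ≤ 1 := by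
      obtain ⟨x, rfl⟩ := exists_circlePoint hP.ne' hz
      have := h x
      rw [fourierSum_eq, norm_mul, ← neg_mul, ← Complex.ofReal_neg, Complex.norm_exp_ofReal_mul_I,
        one_mul] at this
      exact this
    obtain ⟨p, hpd, hp⟩ := fejer_riesz (2 * N) (X ^ (2 * N) - q * conjReflect (2 * N) q)
      (by
        refine (natDegree_sub_le _ _).trans (max_le ?_ ?_)
        · rw [natDegree_X_pow]; omega
        · refine natDegree_mul_le.trans ?_
          have := natDegree_conjReflect_le hqd
          omega)
      (fun z => 1 - ‖q.eval z‖ ^ 2)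
      (fun z hz => by nlinarith [hq1 z hz, norm_nonneg (q.eval z)])
      (fun z hz => by
        rw [eval_sub, eval_mul, eval_conjReflect hqd hz, eval_pow, eval_X]
        rw [Complex.ofReal_sub, ← Complex.normSq_eq_norm_sq, ← Complex.mul_conj,
          Complex.ofReal_one]
        ring)
    obtain ⟨θ, h0, h1, hθ⟩ := exists_fourier_circuit P (2 * N) p q hpd hqd fun z hz => by
      rw [← hp z hz]; ring
    exact ⟨θ, h0, h1, fun x => by rw [output_eq, (hθ x).2, fourierSum_eq]⟩

end

end SingleQubit

namespace SingleQubit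

noncomputable section

/-! ### Outputs of Fourier circuits are truncated Fourier series -/

/-- The functions `∑ c_j e^{iπjx/P}` with `|j| ≤ K` and `j ≡ p` modulo two. -/
def trigSpan (P : ℝ) (K p : ℤ) : Submodule ℂ (ℝ → ℂ) :=
  Submodule.span ℂ
    ((fun (j : ℤ) (x : ℝ) => Complex.exp (Complex.I * ((Real.pi * j / P * x : ℝ) : ℂ))) ''
      {j : ℤ | |j| ≤ K ∧ Even (j - p)})

theorem exp_mul_mem_trigSpan {P : ℝ} {K p : ℤ} {f : ℝ → ℂ} (hf : f ∈ trigSpan P K p) (k : ℤ) :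
    (fun x : ℝ => Complex.exp (Complex.I * ((Real.pi * k / P * x : ℝ) : ℂ)) * f x) ∈
      trigSpan P (K + |k|) (p + k) := by
  induction hf using Submodule.span_induction with
  | mem f hf =>
    obtain ⟨j, ⟨hj, hp⟩, rfl⟩ := hf
    refine Submodule.subset_span ⟨k + j, ⟨?_, ?_⟩, ?_⟩
    · have := abs_add_le k j; linarith
    · rwa [show k + j - (p + k) = j - p by ring]
    · funext x
      simp only
      rw [← Complex.exp_add]
      congr 1
      push_cast
      ring
  | zero =>
    convert! Submodule.zero_mem (trigSpan P (K + |k|) (p + k)) using 1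
    funext x
    simp
  | add f g _ _ hf hg => simpa only [Pi.add_apply, mul_add] using! Submodule.add_mem _ hf hg
  | smul c f _ hf =>
    convert! Submodule.smul_mem _ c hf using 1
    funext x
    simp only [Pi.smul_apply, smul_eq_mul]
    ring

theorem exp_neg_mul_mem_trigSpan {P : ℝ} {K p : ℤ} {f : ℝ → ℂ} (hf : f ∈ trigSpan P K p) (k : ℤ) :
    (fun x : ℝ => Complex.exp (-(Complex.I * ((Real.pi * k / P * x : ℝ) : ℂ))) * f x) ∈
      trigSpan P (K + |k|) (p + k) := by
  have h := exp_mul_mem_trigSpan hf (-k)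
  rw [abs_neg] at h
  -- Only the parity of the last index matters, and `-k` and `k` have the same parity.
  have hp : trigSpan P (K + |k|) (p + -k) = trigSpan P (K + |k|) (p + k) := by
    rw [trigSpan, trigSpan]
    congr 2
    ext j
    simp only [Set.mem_ofPred_eq]
    refine and_congr_right fun _ => ?_
    rw [Int.even_sub, Int.even_sub, Int.even_add, Int.even_add, even_neg]
  rw [hp] at h
  convert! h using 4
  push_cast
  ring

theorem circuit_mem_trigSpan {P : ℝ} {L : ℕ} (θ : Fin L → FourierParams) (k : Fin L → ℤ)
    (h : ∀ i, (θ i).ω = Real.pi * (k i : ℝ) / P) (a b : Fin 2) :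
    (fun x => circuit fourierGate θ x a b) ∈ trigSpan P (∑ i, |k i|) (∑ i, k i) := by
  induction L generalizing a with
  | zero =>
    have : (fun x => circuit fourierGate θ x a b) =
        (1 : Op) a b • fun x : ℝ =>
          Complex.exp (Complex.I * ((Real.pi * (0 : ℤ) / P * x : ℝ) : ℂ)) := by
      funext x
      simp
    rw [this]
    exact Submodule.smul_mem _ _ (Submodule.subset_span ⟨0, by simp, rfl⟩)
  | succ L ih =>
    have ih' := ih (fun i => θ i.castSucc) (fun i => k i.castSucc) (fun i => h _)
    set A : Op := Rz ((θ (Fin.last L)).α + (θ (Fin.last L)).β) * Ry (2 * (θ (Fin.last L)).lam) *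
      Rz ((θ (Fin.last L)).α - (θ (Fin.last L)).β)
    set R : Op := Ry (2 * (θ (Fin.last L)).φ)
    have key (c : Fin 2) := Submodule.add_mem _
      (Submodule.smul_mem _ (R c 0) (ih' 0)) (Submodule.smul_mem _ (R c 1) (ih' 1))
    have hsum := Submodule.add_mem _
      (Submodule.smul_mem _ (A a 0) (exp_mul_mem_trigSpan (key 0) (k (Fin.last L))))
      (Submodule.smul_mem _ (A a 1) (exp_neg_mul_mem_trigSpan (key 1) (k (Fin.last L))))
    rw [Fin.sum_univ_castSucc, Fin.sum_univ_castSucc]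
    convert! hsum using 1
    funext x
    have hg : fourierGate x (θ (Fin.last L)) =
        A * Rz (2 * (Real.pi * k (Fin.last L) / P) * x) * R := by
      rw [← h]; rfl
    have hx : 2 * (Real.pi * (k (Fin.last L) : ℝ) / P) * x / 2 =
        Real.pi * k (Fin.last L) / P * x := by
      ring
    rw [circuit_succ, hg, mul_assoc, mul_assoc, Matrix.mul_apply, Fin.sum_univ_two]
    simp only [Matrix.mul_apply, Fin.sum_univ_two, Rz, hx, Matrix.of_apply, Matrix.cons_val',
      Matrix.cons_val_zero, Matrix.cons_val_one, Matrix.cons_val_fin_one, zero_mul, add_zero,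
      zero_add, Pi.add_apply, Pi.smul_apply, smul_eq_mul]

theorem exists_output_eq_fourierSum {P : ℝ} (N L : ℕ) (θ : Fin L → FourierParams) (k : Fin L → ℤ)
    (h : ∀ i, (θ i).ω = Real.pi * (k i : ℝ) / P) (he : Even (∑ i, k i))
    (hN : ∑ i, |k i| ≤ 2 * (N : ℤ)) :
    ∃ B : ℤ → ℂ, ∀ x : ℝ, output fourierGate θ x = fourierSum P N B x := by
  have hmem := circuit_mem_trigSpan θ k h 1 0
  simp only [output_eq]
  set K := ∑ i, |k i|
  set p := ∑ i, k i
  suffices ∀ f ∈ trigSpan P K p, ∃ B : ℤ → ℂ, ∀ x, f x = fourierSum P N B x from this _ hmem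
  intro f hf
  induction hf using Submodule.span_induction with
  | mem f hf =>
    obtain ⟨j, ⟨hj, hp⟩, rfl⟩ := hf
    -- Evenness turns the half-period frequencies `πj/P` into `2πn/P`.
    obtain ⟨n, hn⟩ : Even j := by simpa using hp.add he
    refine ⟨Pi.single n 1, fun x => ?_⟩
    have hmem : n ∈ Finset.Icc (-(N : ℤ)) N := by
      rw [Finset.mem_Icc]
      have := abs_le.1 (hj.trans hN)
      omega
    rw [fourierSum, Finset.sum_eq_single_of_mem n hmem fun m _ hm => by simp [hm]]
    rw [Pi.single_eq_same, one_mul, hn]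
    beta_reduce
    congr 1
    push_cast
    ring
  | zero => exact ⟨0, fun x => by simp [fourierSum]⟩
  | add f g _ _ hf hg =>
    obtain ⟨B, hB⟩ := hf
    obtain ⟨B', hB'⟩ := hg
    exact ⟨B + B', fun x => by
      simp only [Pi.add_apply, hB, hB', fourierSum, add_mul, Finset.sum_add_distrib]⟩
  | smul c f _ hf =>
    obtain ⟨B, hB⟩ := hf
    exact ⟨c • B, fun x => by
      simp only [Pi.smul_apply, hB, fourierSum, Finset.mul_sum, smul_eq_mul, mul_assoc]⟩

end

end SingleQubit

namespace SingleQubit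

noncomputable section

/-! ### Approximation by Fourier circuits -/

/-- A bounded function with finitely many discontinuities is a limit of continuous functions with
the same bound, which agree with it at the exceptional points and, eventually, on every compact set
that avoids them. -/
theorem exists_continuous_approx {X : Type*} [MetricSpace X] {F : Set X} (hF : F.Finite)
    {f : X → ℂ} {C : ℝ} (hC : ∀ x, ‖f x‖ ≤ C) (hf : ∀ x ∉ F, ContinuousAt f x) :
    ∃ h : ℕ → C(X, ℂ), (∀ n x, ‖h n x‖ ≤ C) ∧ (∀ n, ∀ x ∈ F, h n x = f x) ∧
      ∀ K : Set X, IsCompact K → Disjoint K F → ∀ᶠ n in atTop, ∀ x ∈ K, h n x = f x := by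
  rcases F.eq_empty_or_nonempty with rfl | hne
  · exact ⟨fun _ => ⟨f, continuous_iff_continuousAt.2 fun x => hf x (Set.notMem_empty x)⟩,
      fun _ => hC, fun _ _ _ => rfl, fun _ _ _ => Eventually.of_forall fun _ _ _ => rfl⟩
  have hC0 : 0 ≤ C := (norm_nonneg _).trans (hC hne.some)
  have : Finite F := hF
  -- Norm-preserving Tietze extension of `f` restricted to the finite, hence discrete, set `F`. The
  -- approximant is the convex combination `(1 - χ) L + χ f`, with `χ` zero on `F` and eventually
  -- one on compacts off `F`.
  obtain ⟨L, hLn, hL⟩ := BoundedContinuousFunction.exists_norm_eq_domRestrict_eq hF.isClosed ℝ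
    (BoundedContinuousFunction.ofNormedAddCommGroup (fun x : F => f x)
      continuous_of_discreteTopology C fun x => hC x)
  have hLC (x) : ‖L x‖ ≤ C := (L.norm_coe_le_norm x).trans (hLn.le.trans
    (BoundedContinuousFunction.norm_ofNormedAddCommGroup_le _ hC0 _))
  have hLF (x) (hx : x ∈ F) : L x = f x := congrArg (fun g => g ⟨x, hx⟩) hL
  set χ : ℕ → X → ℝ := fun n x => min 1 (n * Metric.infDist x F) with hχ
  have hχc (n) : Continuous (χ n) :=
    continuous_const.min (continuous_const.mul (Metric.continuous_infDist_pt F))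
  have hχ0 (n x) : 0 ≤ χ n x :=
    le_min zero_le_one (mul_nonneg n.cast_nonneg Metric.infDist_nonneg)
  have hχ1 (n x) : χ n x ≤ 1 := min_le_left _ _
  have hχF (n) (x) (hx : x ∈ F) : χ n x = 0 := by
    simp [hχ, Metric.infDist_zero_of_mem hx]
  refine ⟨fun n => ⟨fun x => L x + χ n x * (f x - L x), ?_⟩, ?_, ?_, ?_⟩
  · refine L.continuous.add (continuous_iff_continuousAt.2 fun x => ?_)
    by_cases hx : x ∈ F
    · rw [ContinuousAt, hχF n x hx, Complex.ofReal_zero, zero_mul]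
      have h1 : Tendsto (fun y => χ n y * (C + C)) (𝓝 x) (𝓝 0) := by
        have := ((hχc n).tendsto x).mul_const (C + C)
        rwa [hχF n x hx, zero_mul] at this
      refine squeeze_zero_norm (fun y => ?_) h1
      rw [norm_mul, Complex.norm_real, Real.norm_eq_abs, abs_of_nonneg (hχ0 n y)]
      exact mul_le_mul_of_nonneg_left
        ((norm_sub_le _ _).trans (add_le_add (hC y) (hLC y))) (hχ0 n y)
    · exact (Complex.continuous_ofReal.comp (hχc n)).continuousAt.mul
        ((hf x hx).sub L.continuous.continuousAt)
  · intro n x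
    have h1 : L x + χ n x * (f x - L x) = ((1 - χ n x : ℝ) : ℂ) * L x + χ n x * f x := by
      push_cast; ring
    have h2 : ‖((1 - χ n x : ℝ) : ℂ) * L x + χ n x * f x‖ ≤ C := by
      refine (norm_add_le _ _).trans ?_
      rw [norm_mul, norm_mul, Complex.norm_real, Complex.norm_real, Real.norm_eq_abs,
        Real.norm_eq_abs, abs_of_nonneg (hχ0 n x), abs_of_nonneg (sub_nonneg.2 (hχ1 n x))]
      have := mul_le_mul_of_nonneg_left (hLC x) (sub_nonneg.2 (hχ1 n x))
      have := mul_le_mul_of_nonneg_left (hC x) (hχ0 n x)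
      linarith
    rw [← h1] at h2
    exact h2
  · intro n x hx
    simp [hχF n x hx, hLF x hx]
  · intro K hK hKF
    rcases K.eq_empty_or_nonempty with rfl | hKne
    · simp
    obtain ⟨x₀, hx₀, hmin⟩ := hK.exists_isMinOn hKne (Metric.continuous_infDist_pt F).continuousOn
    have hpos : 0 < Metric.infDist x₀ F :=
      (hF.isClosed.notMem_iff_infDist_pos hne).1 (Set.disjoint_left.1 hKF hx₀)
    obtain ⟨n₀, hn₀⟩ := exists_nat_ge (1 / Metric.infDist x₀ F)
    filter_upwards [eventually_ge_atTop n₀] with n hn x hx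
    have h1 : χ n x = 1 := by
      refine min_eq_left ?_
      have h2 : Metric.infDist x₀ F ≤ Metric.infDist x F := hmin hx
      have h3 : (n₀ : ℝ) ≤ n := by exact_mod_cast hn
      have h4 := (div_le_iff₀ hpos).1 hn₀
      have h5 := mul_le_mul h3 h2 hpos.le n.cast_nonneg
      linarith
    simp [h1]

theorem exists_fourierSum_eq_of_mem_span {P : ℝ} {p : C(AddCircle P, ℂ)}
    (hp : p ∈ Submodule.span ℂ (Set.range (@fourier P))) :
    ∃ (N₀ : ℕ) (B : ℤ → ℂ), ∀ N ≥ N₀, ∀ x : ℝ, fourierSum P N B x = p x := by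
  obtain ⟨c, rfl⟩ := Finsupp.mem_span_range_iff_exists_finsupp.1 hp
  refine ⟨c.support.sup Int.natAbs, c, fun N hN x => ?_⟩
  have hsub : c.support ⊆ Finset.Icc (-(N : ℤ)) N := fun n hn => by
    have : n.natAbs ≤ N := (Finset.le_sup (f := Int.natAbs) hn).trans hN
    rw [Finset.mem_Icc]
    omega
  rw [fourierSum, ← Finset.sum_subset hsub fun n _ hn => by
    rw [Finsupp.notMem_support_iff.1 hn, zero_mul]]
  simp only [Finsupp.sum, ContinuousMap.coe_sum, Finset.sum_apply, ContinuousMap.coe_smul,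
    Pi.smul_apply, smul_eq_mul, fourier_coe_apply]

/-- The constraint on the frequencies of a Fourier circuit. -/
def StandardFrequencies (P : ℝ) {N : ℕ} (θ : Fin (2 * N + 1) → FourierParams) : Prop :=
  (θ 0).ω = 0 ∧ ∀ i, i ≠ 0 → (θ i).ω = Real.pi / P

/-- A trigonometric polynomial within `δ = ε / 2` of `g` may exceed modulus `1`, but at most by `δ`.
Division by `1 + δ` makes it realizable and costs at most another `δ`. -/
theorem exists_output_approx {P : ℝ} (hP : 0 < P) (g : C(AddCircle P, ℂ))
    (hg : ∀ x, ‖g x‖ ≤ 1) {ε : ℝ} (hε : 0 < ε) :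
    ∃ N₀ : ℕ, ∀ N ≥ N₀, ∃ θ : Fin (2 * N + 1) → FourierParams, StandardFrequencies P θ ∧
      ∀ x : ℝ, ‖output fourierGate θ x - g x‖ < ε := by
  have : Fact (0 < P) := ⟨hP⟩
  have hmem : g ∈ (Submodule.span ℂ (Set.range (@fourier P))).topologicalClosure := by
    rw [span_fourier_closure_eq_top]; trivial
  obtain ⟨p, hp, hpg⟩ := Metric.mem_closure_iff.1 hmem (ε / 2) (half_pos hε)
  set δ := ε / 2 with hδ
  have hδ0 : 0 < δ := half_pos hε
  have hpd (x) : ‖p x - g x‖ < δ := by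
    rw [← dist_eq_norm, dist_comm]
    exact (ContinuousMap.dist_apply_le_dist x).trans_lt hpg
  have hpn (x) : ‖p x‖ ≤ 1 + δ := by
    have := norm_add_le (p x - g x) (g x)
    rw [sub_add_cancel] at this
    linarith [hpd x, hg x]
  have hδ1 : 0 < 1 + δ := by linarith
  set q : C(AddCircle P, ℂ) := ((1 + δ : ℝ) : ℂ)⁻¹ • p with hq
  obtain ⟨N₀, B, hB⟩ := exists_fourierSum_eq_of_mem_span (Submodule.smul_mem _
    ((1 + δ : ℝ) : ℂ)⁻¹ hp)
  have hqn (x) : ‖q x‖ = (1 + δ)⁻¹ * ‖p x‖ := by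
    rw [hq, ContinuousMap.smul_apply, norm_smul, norm_inv, Complex.norm_real, Real.norm_eq_abs,
      abs_of_pos hδ1]
  have hqp (x) : ‖q x - p x‖ ≤ δ := by
    have : q x - p x = -((δ * (1 + δ)⁻¹ : ℝ) : ℂ) * p x := by
      have h1 : ((1 + δ : ℝ) : ℂ) ≠ 0 := by exact_mod_cast hδ1.ne'
      rw [hq, ContinuousMap.smul_apply, smul_eq_mul, Complex.ofReal_mul, Complex.ofReal_inv]
      field_simp
      push_cast
      ring
    rw [this, norm_mul, norm_neg, Complex.norm_real, Real.norm_eq_abs, abs_of_pos (by positivity),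
      mul_assoc]
    have h1 : (1 + δ)⁻¹ * ‖p x‖ ≤ 1 := by
      rw [inv_mul_le_iff₀ hδ1]; linarith [hpn x]
    nlinarith
  refine ⟨N₀, fun N hN => ?_⟩
  obtain ⟨θ, h0, h1, hθ⟩ := (exists_output_eq_fourierSum_iff hP N B).2 fun x => by
    rw [hB N hN x]
    change ‖q x‖ ≤ 1
    rw [hqn, inv_mul_le_iff₀ hδ1]
    linarith [hpn x]
  refine ⟨θ, ⟨h0, h1⟩, fun x => ?_⟩
  rw [hθ, hB N hN x]
  have h2 := norm_add_le (q x - p x) (p x - g x)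
  rw [sub_add_sub_cancel] at h2
  have h3 := hqp x
  have h4 := hpd x
  change ‖q x - g x‖ < ε
  linarith

/-- Slow reindexing: if accuracy level `n` needs size `d n`, then at size `N` one aims for the
largest `n ≤ N` that is affordable. -/
theorem exists_tendsto_atTop_eventually_le (d : ℕ → ℕ) :
    ∃ κ : ℕ → ℕ, Tendsto κ atTop atTop ∧ ∀ᶠ N in atTop, d (κ N) ≤ N := by
  refine ⟨fun N => Nat.findGreatest (fun n => d n ≤ N) N, ?_, ?_⟩
  · refine tendsto_atTop.2 fun n => ?_
    filter_upwards [eventually_ge_atTop n, eventually_ge_atTop (d n)] with N h1 h2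
    exact Nat.le_findGreatest h1 h2
  · filter_upwards [eventually_ge_atTop (d 0)] with N hN
    exact Nat.findGreatest_spec (P := fun n => d n ≤ N) (Nat.zero_le N) hN

theorem exists_output_sequence {P : ℝ} (hP : 0 < P) (h : ℕ → C(AddCircle P, ℂ))
    (hh : ∀ n x, ‖h n x‖ ≤ 1) :
    ∃ (θ : (N : ℕ) → Fin (2 * N + 1) → FourierParams) (κ : ℕ → ℕ),
      (∀ N, StandardFrequencies P (θ N)) ∧ Tendsto κ atTop atTop ∧
      ∀ᶠ N in atTop, ∀ x : ℝ,
        ‖output fourierGate (θ N) x - h (κ N) x‖ < 1 / ((κ N : ℝ) + 1) := by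
  choose d hd using fun n => exists_output_approx hP (h n) (hh n) (Nat.one_div_pos_of_nat (n := n))
  obtain ⟨κ, hκ, hle⟩ := exists_tendsto_atTop_eventually_le d
  have hex (N : ℕ) : ∃ θ : Fin (2 * N + 1) → FourierParams, StandardFrequencies P θ ∧
      (d (κ N) ≤ N → ∀ x : ℝ, ‖output fourierGate θ x - h (κ N) x‖ < 1 / ((κ N : ℝ) + 1)) := by
    by_cases hN : d (κ N) ≤ N
    · obtain ⟨θ, h1, h2⟩ := hd (κ N) N hN
      exact ⟨θ, h1, fun _ => h2⟩
    · exact ⟨fun i => ⟨if i = 0 then 0 else Real.pi / P, 0, 0, 0, 0⟩,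
        ⟨by simp, fun i hi => by simp [hi]⟩, fun h => absurd h hN⟩
  choose θ h1 h2 using hex
  exact ⟨θ, κ, h1, hκ, hle.mono fun N hN => h2 N hN⟩

/-- The values of `z / C` on `[a, a + P)` are transported to the circle. The seam `a` joins the
exceptional points unless `z` closes up continuously, in which case there are none. -/
theorem exists_circuits_tendsto {P : ℝ} (hP : 0 < P) (a C : ℝ) (z : ℝ → ℂ) (D : Set ℝ)
    (hD : D.Finite) (hz : ContinuousOn z (Set.Ioo a (a + P) \ D))
    (hC : ∀ x ∈ Set.Ico a (a + P), ‖z x‖ ≤ C) :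
    ∃ θ : (N : ℕ) → Fin (2 * N + 1) → FourierParams,
      (∀ N, (θ N 0).ω = 0 ∧ ∀ i, i ≠ 0 → (θ N i).ω = Real.pi / P) ∧
      (∀ x ∈ Set.Ico a (a + P),
        Tendsto (fun N => (C : ℂ) * output fourierGate (θ N) x) atTop (𝓝 (z x))) ∧
      (∀ K : Set ℝ, IsCompact K → K ⊆ Set.Ioo a (a + P) \ D →
        TendstoUniformlyOn (fun N x => (C : ℂ) * output fourierGate (θ N) x) z atTop K) ∧
      (ContinuousOn z (Set.Icc a (a + P)) → z a = z (a + P) →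
        TendstoUniformlyOn (fun N x => (C : ℂ) * output fourierGate (θ N) x) z atTop
          (Set.Icc a (a + P))) := by
  have : Fact (0 < P) := ⟨hP⟩
  have haI : a ∈ Set.Ico a (a + P) := ⟨le_rfl, by linarith⟩
  have hC0 : 0 ≤ C := (norm_nonneg _).trans (hC a haI)
  set f : AddCircle P → ℂ := fun y => (C : ℂ)⁻¹ * AddCircle.liftIco P a z y with hf
  have hfc (x : ℝ) (hx : x ∈ Set.Ico a (a + P)) : f x = (C : ℂ)⁻¹ * z x := by
    rw [hf]
    simp only
    rw [AddCircle.liftIco_coe_apply hx]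
  have hsurj (y : AddCircle P) : ∃ x ∈ Set.Ico a (a + P), (x : AddCircle P) = y :=
    ⟨AddCircle.equivIco P a y, (AddCircle.equivIco P a y).2, AddCircle.coe_equivIco⟩
  have hCf (x : ℝ) (hx : x ∈ Set.Ico a (a + P)) : (C : ℂ) * f x = z x := by
    rw [hfc x hx]
    rcases eq_or_ne C 0 with h0 | h0
    -- For `C = 0` the bound forces `z = 0`, so the convention `0⁻¹ = 0` is harmless.
    · have : z x = 0 := norm_le_zero_iff.1 (h0 ▸ hC x hx)
      simp [this]
    · rw [mul_inv_cancel_left₀ (by exact_mod_cast h0)]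
  have hf1 (y : AddCircle P) : ‖f y‖ ≤ 1 := by
    obtain ⟨x, hx, rfl⟩ := hsurj y
    rw [hfc x hx, norm_mul, norm_inv, Complex.norm_real, Real.norm_eq_abs, abs_of_nonneg hC0]
    exact (mul_le_mul_of_nonneg_left (hC x hx) (inv_nonneg.2 hC0)).trans (inv_mul_le_one)
  obtain ⟨F, hF, hFc, hFK, hFe⟩ : ∃ F : Set (AddCircle P), F.Finite ∧
      (∀ y ∉ F, ContinuousAt f y) ∧
      (∀ x ∈ Set.Ioo a (a + P) \ D, (x : AddCircle P) ∉ F) ∧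
      (ContinuousOn z (Set.Icc a (a + P)) → z a = z (a + P) → F = ∅) := by
    by_cases hper : ContinuousOn z (Set.Icc a (a + P)) ∧ z a = z (a + P)
    · refine ⟨∅, Set.finite_empty, fun y _ => ?_, fun _ _ => Set.notMem_empty _, fun _ _ => rfl⟩
      exact (continuous_const.mul
        (AddCircle.liftIco_continuous hper.2 hper.1)).continuousAt
    · refine ⟨(fun x : ℝ => (x : AddCircle P)) '' (insert a D ∩ Set.Ico a (a + P)),
        ((hD.insert a).inter_of_left _).image _, fun y hy => ?_, ?_,
        fun h1 h2 => absurd ⟨h1, h2⟩ hper⟩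
      · have hx := (AddCircle.equivIco P a y).2
        have hy' : ((AddCircle.equivIco P a y : ℝ) : AddCircle P) = y := AddCircle.coe_equivIco
        have hxD : (AddCircle.equivIco P a y : ℝ) ∉ insert a D := fun h =>
          hy ⟨_, ⟨h, hx⟩, hy'⟩
        rw [Set.mem_insert_iff, not_or] at hxD
        have hxI : (AddCircle.equivIco P a y : ℝ) ∈ Set.Ioo a (a + P) \ D :=
          ⟨⟨lt_of_le_of_ne hx.1 (Ne.symm hxD.1), hx.2⟩, hxD.2⟩
        have hcz := hz.continuousAt ((isOpen_Ioo.sdiff hD.isClosed).mem_nhds hxI)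
        have hya : y ≠ a := by
          rintro rfl
          exact hy ⟨a, ⟨Set.mem_insert _ _, haI⟩, rfl⟩
        have hce : ContinuousAt (fun y => (AddCircle.equivIco P a y : ℝ)) y :=
          continuousAt_subtype_val.comp (AddCircle.continuousAt_equivIco P a hya)
        exact continuousAt_const.mul (ContinuousAt.comp (g := z) hcz hce)
      · rintro x hx ⟨d, ⟨hd, hdI⟩, hdx⟩
        have hxd : d = x := (AddCircle.coe_eq_coe_iff_of_mem_Ico hdI ⟨hx.1.1.le, hx.1.2⟩).1 hdx
        subst hxd
        rcases hd with h | h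
        · exact hx.1.1.ne' h
        · exact hx.2 h
  obtain ⟨h, hh1, hhF, hhK⟩ := exists_continuous_approx hF hf1 hFc
  obtain ⟨θ, κ, hθ, hκ, happ⟩ := exists_output_sequence hP h hh1
  have main (S : Set ℝ) (hS : ∀ᶠ n in atTop, ∀ x ∈ S, (C : ℂ) * h n x = z x) :
      TendstoUniformlyOn (fun N x => (C : ℂ) * output fourierGate (θ N) x) z atTop S := by
    rw [Metric.tendstoUniformlyOn_iff]
    intro ε hε
    have hlim : Tendsto (fun N => C * (1 / ((κ N : ℝ) + 1))) atTop (𝓝 0) := by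
      simpa using (tendsto_one_div_add_atTop_nhds_zero_nat.comp hκ).const_mul C
    filter_upwards [happ, hκ.eventually hS, hlim.eventually_lt_const hε] with N h1 h2 h3 x hx
    rw [dist_comm, dist_eq_norm, ← h2 x hx, ← mul_sub, norm_mul, Complex.norm_real,
      Real.norm_eq_abs, abs_of_nonneg hC0]
    exact (mul_le_mul_of_nonneg_left (h1 x).le hC0).trans_lt h3
  refine ⟨θ, hθ, fun x hx => ?_, fun K hK hKI => ?_, fun hc hp => ?_⟩
  · refine (main {x} ?_).tendsto_at (Set.mem_singleton x)
    simp only [Set.mem_singleton_iff, forall_eq]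
    -- At exceptional points the approximants equal `f` exactly, so pointwise convergence holds
    -- there too.
    by_cases hxF : (x : AddCircle P) ∈ F
    · exact Eventually.of_forall fun n => by rw [hhF n _ hxF, hCf x hx]
    · filter_upwards [hhK {(x : AddCircle P)} isCompact_singleton
        (Set.disjoint_singleton_left.2 hxF)] with n hn
      rw [hn _ rfl, hCf x hx]
  · refine main K ?_
    filter_upwards [hhK ((fun x : ℝ => (x : AddCircle P)) '' K)
      (hK.image (AddCircle.continuous_mk' P)) (Set.disjoint_left.2 (by
        rintro _ ⟨x, hx, rfl⟩
        exact hFK x (hKI hx)))] with n hn x hx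
    rw [hn _ ⟨x, hx, rfl⟩, hCf x ⟨(hKI hx).1.1.le, (hKI hx).1.2⟩]
  · refine main _ ?_
    filter_upwards [hhK Set.univ isCompact_univ (by rw [hFe hc hp]; exact Set.disjoint_empty _)]
      with n hn x hx
    rw [hn _ trivial]
    rcases eq_or_lt_of_le hx.2 with h1 | h1
    · rw [h1, ← hp, AddCircle.coe_add_period, hCf a haI]
    · exact hCf x ⟨hx.1, h1⟩

end

end SingleQubit

namespace SingleQubit

noncomputable section

/-! ### Outputs of UAT circuits are trigonometric sums -/

/-- One term of the expansion of the amplitude of a UAT circuit. -/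
def pathTerm {m N : ℕ} (ε : ℤˣ) (T : Fin N → Bool) (s : Fin N → ℤˣ) (θ : Fin N → UATParams m)
    (x : Fin m → ℝ) : ℂ :=
  (((((ε : ℤ) : ℝ) * ∏ n, if T n then Real.sin (θ n).φ else Real.cos (θ n).φ) : ℝ) : ℂ) *
    Complex.exp (Complex.I * ((∑ n, ((s n : ℤ) : ℝ) * (θ n).α : ℝ) : ℂ)) *
    Complex.exp (Complex.I * (((∑ n, ((s n : ℤ) : ℝ) • (θ n).ω) ⬝ᵥ x : ℝ) : ℂ))

/-- Prepending a factor for a new last layer. -/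
theorem pathTerm_snoc {m N : ℕ} (ε ε' : ℤˣ) (T : Fin N → Bool) (t : Bool) (s : Fin N → ℤˣ)
    (σ : ℤˣ) (θ : Fin (N + 1) → UATParams m) (x : Fin m → ℝ) :
    pathTerm (ε' * ε) (Fin.snoc T t : Fin (N + 1) → Bool) (Fin.snoc s σ : Fin (N + 1) → ℤˣ) θ x =
      pathTerm (N := 1) ε' (fun _ => t) (fun _ => σ) (fun _ => θ (Fin.last N)) x *
        pathTerm ε T s (fun i => θ i.castSucc) x := by
  simp only [pathTerm, Fin.prod_univ_castSucc, Fin.sum_univ_castSucc, Fin.snoc_castSucc,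
    Fin.snoc_last, Finset.univ_eq_empty, Finset.prod_empty, Finset.sum_empty, add_dotProduct,
    Complex.ofReal_add, mul_add, Complex.exp_add, Units.val_mul, Int.cast_mul, Complex.ofReal_mul,
    zero_dotProduct, Complex.ofReal_zero, mul_zero, Complex.exp_zero,
    one_mul]
  ring

variable {m : ℕ} {U : (Fin m → ℝ) → UATParams m → Op}

/-- `R_z` is diagonal, so no sum arises: off-diagonal entries carry the sine, and the sign of the
phase is fixed by the column or by the row, according to the order of the rotations. -/
theorem exists_gate_entry_eq (hU : U = uatGate ∨ U = uatGateZY) (a b : Fin 2) :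
    ∃ (ε : ℤˣ) (t : Bool) (σ : ℤˣ), ∀ (θ : UATParams m) (x : Fin m → ℝ),
      U x θ a b = pathTerm (N := 1) ε (fun _ => t) (fun _ => σ) (fun _ => θ) x := by
  have key (ε : ℤˣ) (t : Bool) (σ : ℤˣ) (θ : UATParams m) (x : Fin m → ℝ) :
      pathTerm (N := 1) ε (fun _ => t) (fun _ => σ) (fun _ => θ) x =
        (ε : ℤ) * (if t then Real.sin θ.φ else Real.cos θ.φ : ℝ) *
          Complex.exp (((σ : ℤ) : ℂ) * (Complex.I * ((θ.ω ⬝ᵥ x + θ.α : ℝ) : ℂ))) := by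
    simp only [pathTerm, Finset.univ_unique, Finset.prod_singleton, Finset.sum_singleton,
      smul_dotProduct, smul_eq_mul]
    rw [mul_assoc, ← Complex.exp_add]
    push_cast
    congr 2
    ring
  simp only [key]
  have h2 (θ : UATParams m) (x : Fin m → ℝ) :
      (2 * (θ.ω ⬝ᵥ x) + 2 * θ.α) / 2 = θ.ω ⬝ᵥ x + θ.α := by ring
  rcases hU with rfl | rfl
  · refine ⟨if a = 0 ∧ b = 1 then -1 else 1, a ≠ b, if b = 0 then 1 else -1, fun θ x => ?_⟩
    simp only [uatGate, Matrix.mul_apply, Fin.sum_univ_two, Ry, Rz, h2]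
    fin_cases a <;> fin_cases b <;> simp
  · refine ⟨if a = 0 ∧ b = 1 then -1 else 1, a ≠ b, if a = 0 then 1 else -1, fun θ x => ?_⟩
    simp only [uatGateZY, Matrix.mul_apply, Fin.sum_univ_two, Ry, Rz]
    fin_cases a <;> fin_cases b <;> simp [mul_comm]

/-- Sum over paths: `N + 1` layers have `N` intermediate basis states, and a new layer doubles the
index type through the choice of `c`. -/
theorem exists_circuit_entry_eq_sum (hU : U = uatGate ∨ U = uatGateZY) (N : ℕ) (a b : Fin 2) :
    ∃ (ι : Type) (_ : Fintype ι) (_ : Fintype.card ι = 2 ^ N) (ε : ι → ℤˣ)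
      (T : ι → Fin (N + 1) → Bool) (s : ι → Fin (N + 1) → ℤˣ),
      ∀ (θ : Fin (N + 1) → UATParams m) (x : Fin m → ℝ),
        circuit U θ x a b = ∑ j, pathTerm (ε j) (T j) (s j) θ x := by
  induction N generalizing a with
  | zero =>
    obtain ⟨ε, t, σ, h⟩ := exists_gate_entry_eq hU a b
    refine ⟨Unit, inferInstance, rfl, fun _ => ε, fun _ _ => t, fun _ _ => σ, fun θ x => ?_⟩
    rw [circuit_succ, circuit_zero, mul_one, h]
    simp only [Finset.univ_unique, Finset.sum_singleton]
    congr 1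
    funext i
    rw [Fin.fin_one_eq_zero i]
    rfl
  | succ N ih =>
    choose ι hι hcard ε T s h using fun c => ih c
    choose ε' t σ h' using fun c => exists_gate_entry_eq hU a c
    refine ⟨(c : Fin 2) × ι c, inferInstance, ?_, fun j => ε' j.1 * ε j.1 j.2,
      fun j => Fin.snoc (T j.1 j.2) (t j.1), fun j => Fin.snoc (s j.1 j.2) (σ j.1), fun θ x => ?_⟩
    · rw [Fintype.card_sigma, Fin.sum_univ_two, hcard, hcard]; ring
    · rw [circuit_succ, Matrix.mul_apply, Fintype.sum_sigma]
      refine Finset.sum_congr rfl fun c _ => ?_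
      rw [h, h', Finset.mul_sum]
      exact Finset.sum_congr rfl fun j _ => (pathTerm_snoc ..).symm

theorem exists_output_eq_trigonometric_sum (hU : U = uatGate ∨ U = uatGateZY) (N : ℕ)
    (hN : 1 ≤ N) :
    ∃ (ε : Fin (2 ^ (N - 1)) → ℤˣ) (T : Fin (2 ^ (N - 1)) → Fin N → Bool)
      (s : Fin (2 ^ (N - 1)) → Fin N → ℤˣ),
      ∀ (θ : Fin N → UATParams m) (x : Fin m → ℝ),
        output U θ x = ∑ j, pathTerm (ε j) (T j) (s j) θ x := by
  obtain ⟨N, rfl⟩ := Nat.exists_eq_add_of_le' hN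
  obtain ⟨ι, _, hcard, ε, T, s, h⟩ := exists_circuit_entry_eq_sum hU N 1 0
  let e : Fin (2 ^ (N + 1 - 1)) ≃ ι :=
    (finCongr (by rw [hcard]; rfl)).trans (Fintype.equivFin ι).symm
  refine ⟨ε ∘ e, T ∘ e, s ∘ e, fun θ x => ?_⟩
  rw [output_eq, h]
  exact (Equiv.sum_comp e _).symm

end

end SingleQubit

namespace SingleQubit

open ComplexConjugate

noncomputable section

/-! ### Closed monoids of operator-valued functions -/

theorem uniformContinuous_colMatrix : UniformContinuous fun p : ℂ × ℂ => colMatrix p.1 p.2 := by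
  have hconj : UniformContinuous (fun z : ℂ => conj z) := Complex.isometry_conj.uniformContinuous
  refine uniformContinuous_pi.2 fun i => uniformContinuous_pi.2 fun j => ?_
  fin_cases i <;> fin_cases j
  · exact uniformContinuous_fst
  · exact (hconj.comp uniformContinuous_snd).neg
  · exact uniformContinuous_snd
  · exact hconj.comp uniformContinuous_fst

theorem continuous_Rz : Continuous Rz := by
  have : Rz = fun t => colMatrix (Complex.exp (Complex.I * ((t / 2 : ℝ) : ℂ))) 0 :=
    funext Rz_eq_colMatrix
  have hc : Continuous fun t : ℝ => (Complex.exp (Complex.I * ((t / 2 : ℝ) : ℂ)), (0 : ℂ)) := by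
    fun_prop
  rw [this]
  exact uniformContinuous_colMatrix.continuous.comp hc

theorem continuous_Ry : Continuous Ry := by
  have : Ry = fun t => colMatrix (Real.cos (t / 2) : ℂ) (Real.sin (t / 2) : ℂ) :=
    funext Ry_eq_colMatrix
  have hc : Continuous fun t : ℝ => ((Real.cos (t / 2) : ℂ), (Real.sin (t / 2) : ℂ)) := by
    fun_prop
  rw [this]
  exact uniformContinuous_colMatrix.continuous.comp hc

section ClosedMonoid

variable {X : Type*} [TopologicalSpace X]

/-- The function `x ↦ R_z(h x)`. -/
def rzMap (h : C(X, ℝ)) : C(X, Op) := ContinuousMap.comp ⟨Rz, continuous_Rz⟩ h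

/-- The function `x ↦ R_y(h x)`. -/
def ryMap (h : C(X, ℝ)) : C(X, Op) := ContinuousMap.comp ⟨Ry, continuous_Ry⟩ h

@[simp] theorem rzMap_apply (h : C(X, ℝ)) (x : X) : rzMap h x = Rz (h x) := rfl

theorem rzMap_add (h k : C(X, ℝ)) : rzMap (h + k) = rzMap h * rzMap k :=
  ContinuousMap.ext fun _ => Rz_add _ _

theorem continuous_rzMap : Continuous (rzMap : C(X, ℝ) → C(X, Op)) :=
  ContinuousMap.continuous_postcomp _

variable {S : Submonoid C(X, Op)}

/-- A Fourier circuit uses only constants and `R_z(2ωy)`, so `h` can be substituted for its variable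
`y` inside `S`. -/
theorem exists_mem_eq_fourierCircuit (hconst : ∀ M ∈ SU2, ContinuousMap.const X M ∈ S)
    {h : C(X, ℝ)} (hh : ∀ t : ℝ, rzMap (t • h) ∈ S) {k : ℕ} (θ : Fin k → FourierParams) :
    ∃ g ∈ S, ∀ x, g x = circuit fourierGate θ (h x) := by
  induction k with
  | zero => exact ⟨1, S.one_mem, fun x => by simp⟩
  | succ k ih =>
    obtain ⟨g, hg, hgx⟩ := ih fun i => θ i.castSucc
    set t := θ (Fin.last k)
    refine ⟨.const X (Rz (t.α + t.β) * Ry (2 * t.lam) * Rz (t.α - t.β)) *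
      rzMap ((2 * t.ω) • h) * .const X (Ry (2 * t.φ)) * g,
      mul_mem (mul_mem (mul_mem (hconst _ ?_) (hh _)) (hconst _ (Ry_mem_SU2 _))) hg, fun x => ?_⟩
    · exact mul_mem (mul_mem (Rz_mem_SU2 _) (Ry_mem_SU2 _)) (Rz_mem_SU2 _)
    · rw [circuit_succ]
      simp [hgx, fourierGate, t]

/-- Diagonalization of `R_y(t)`: `(i, 1)` is an eigenvector with eigenvalue `e^{it/2}`. -/
theorem Ry_eq_conj_Rz {s : ℝ} (hs : s ^ 2 = 1 / 2) (t : ℝ) :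
    Ry t = colMatrix (Complex.I * s) s * Rz t * colMatrix (-(Complex.I * s)) (-s) := by
  have hs' : (s : ℂ) ^ 2 = 1 / 2 := by rw [← Complex.ofReal_pow, hs]; norm_num
  rw [Ry_eq_colMatrix, Rz_eq_colMatrix, colMatrix_mul, colMatrix_mul]
  simp only [map_mul, Complex.conj_I, Complex.conj_ofReal, ← Complex.exp_conj, mul_zero,
    sub_zero, add_zero]
  rw [Complex.ofReal_cos, Complex.ofReal_sin, Complex.cos, Complex.sin, mul_comm _ Complex.I,
    neg_mul, mul_comm _ Complex.I]
  set e := Complex.exp (Complex.I * ((t / 2 : ℝ) : ℂ))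
  rw [neg_mul Complex.I]
  set e' := Complex.exp (-(Complex.I * ((t / 2 : ℝ) : ℂ)))
  congr 1
  · linear_combination (-(e + e')) * hs' + s ^ 2 * e * Complex.I_mul_I
  · linear_combination (-Complex.I * (e' - e)) * hs'

/-- The lower left entry of `R_y(π/2 + q) R_z(2c) R_y(π/2 - q)` is `cos c + i sin c sin q`. Take
`cos c` to be the real part of `f` and solve for `q`; the bound `r < 1` keeps `sin c` positive, so
`q` is continuous. -/
theorem exists_mem_apply_one_zero_eq (hconst : ∀ M ∈ SU2, ContinuousMap.const X M ∈ S)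
    (hz : ∀ h : C(X, ℝ), rzMap h ∈ S) (f : C(X, ℂ)) {r : ℝ} (hr : r < 1) (hf : ∀ x, ‖f x‖ ≤ r) :
    ∃ g ∈ S, ∀ x, g x 1 0 = f x := by
  obtain ⟨s, hs⟩ : ∃ s : ℝ, s ^ 2 = 1 / 2 := ⟨_, Real.sq_sqrt (by norm_num)⟩
  have hy (h : C(X, ℝ)) : ryMap h ∈ S := by
    have : ryMap h = .const X (colMatrix (Complex.I * s) s) * rzMap h *
        .const X (colMatrix (-(Complex.I * s)) (-s)) :=
      ContinuousMap.ext fun x => Ry_eq_conj_Rz hs (h x)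
    rw [this]
    refine mul_mem (mul_mem (hconst _ ⟨_, _, ?_, rfl⟩) (hz h)) (hconst _ ⟨_, _, ?_, rfl⟩)
    · rw [norm_mul, Complex.norm_I, one_mul, Complex.norm_real, Real.norm_eq_abs, sq_abs, hs]
      norm_num
    · rw [norm_neg, norm_neg, norm_mul, Complex.norm_I, one_mul, Complex.norm_real,
        Real.norm_eq_abs, sq_abs, hs]
      norm_num
  have hn (x) : (f x).re ^ 2 + (f x).im ^ 2 < 1 := by
    have h1 := Complex.sq_norm (f x)
    rw [Complex.normSq_apply] at h1
    have h2 := (hf x).trans_lt hr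
    nlinarith [norm_nonneg (f x)]
  set w : X → ℝ := fun x => Real.sqrt (1 - (f x).re ^ 2) with hw
  have hw0 (x) : 0 < w x := Real.sqrt_pos.2 (by nlinarith [hn x, sq_nonneg (f x).im])
  have hw2 (x) : w x ^ 2 = 1 - (f x).re ^ 2 :=
    Real.sq_sqrt (by nlinarith [hn x, sq_nonneg (f x).im])
  have hwc : Continuous w := by fun_prop
  set c : C(X, ℝ) := ⟨fun x => Real.arccos (f x).re, by fun_prop⟩ with hc
  set q : C(X, ℝ) := ⟨fun x => Real.arcsin ((f x).im / w x),
    Real.continuous_arcsin.comp ((by fun_prop : Continuous fun x => (f x).im).div hwc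
      fun x => (hw0 x).ne')⟩ with hq
  refine ⟨ryMap (.const X (Real.pi / 2) + q) * rzMap ((2 : ℝ) • c) *
    ryMap (.const X (Real.pi / 2) - q), mul_mem (mul_mem (hy _) (hz _)) (hy _), fun x => ?_⟩
  have hcos : Real.cos (c x) = (f x).re := by
    have := abs_le_one_iff_mul_self_le_one.2 (by nlinarith [hn x, sq_nonneg (f x).im] :
      (f x).re * (f x).re ≤ 1)
    exact Real.cos_arccos (abs_le.1 this).1 (abs_le.1 this).2
  have hsin : Real.sin (c x) = w x := Real.sin_arccos _
  have hq' : w x * Real.sin (q x) = (f x).im := by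
    have h1 : |(f x).im / w x| ≤ 1 := by
      rw [abs_div, abs_of_pos (hw0 x), div_le_one (hw0 x)]
      exact abs_le_of_sq_le_sq (by nlinarith [hn x, hw2 x]) (hw0 x).le
    rw [hq]
    simp only [ContinuousMap.coe_mk]
    rw [Real.sin_arcsin (abs_le.1 h1).1 (abs_le.1 h1).2, mul_div_cancel₀ _ (hw0 x).ne']
  set A : ℝ := (Real.pi / 2 + q x) / 2 with hA
  set B : ℝ := (Real.pi / 2 - q x) / 2 with hB
  have hadd : Real.sin A * Real.cos B + Real.cos A * Real.sin B = 1 := by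
    rw [← Real.sin_add, hA, hB, ← add_div, add_add_sub_cancel, add_halves, Real.sin_pi_div_two]
  have hsub : Real.sin A * Real.cos B - Real.cos A * Real.sin B = Real.sin (q x) := by
    rw [← Real.sin_sub, hA, hB]
    congr 1
    ring
  have hexp : Complex.exp (Complex.I * (((2 * c x) / 2 : ℝ) : ℂ)) =
      (f x).re + w x * Complex.I := by
    rw [mul_div_cancel_left₀ _ (two_ne_zero), mul_comm, Complex.exp_mul_I, ← Complex.ofReal_cos,
      ← Complex.ofReal_sin, hcos, hsin]
  have hval : Ry (Real.pi / 2 + q x) * Rz (2 * c x) * Ry (Real.pi / 2 - q x) =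
      colMatrix (Real.cos A) (Real.sin A) * colMatrix ((f x).re + w x * Complex.I) 0 *
        colMatrix (Real.cos B) (Real.sin B) := by
    rw [Ry_eq_colMatrix, Ry_eq_colMatrix, Rz_eq_colMatrix, hexp]
  change (Ry (Real.pi / 2 + q x) * Rz (2 * c x) * Ry (Real.pi / 2 - q x)) 1 0 = f x
  rw [hval, colMatrix_mul, colMatrix_mul]
  simp only [colMatrix, Matrix.of_apply, Matrix.cons_val', Matrix.cons_val_zero,
    Matrix.cons_val_one, Matrix.cons_val_fin_one, map_sub, map_add, map_mul, Complex.conj_ofReal,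
    Complex.conj_I, mul_zero, sub_zero, add_zero]
  have hadd' := congrArg (fun y : ℝ => (y : ℂ)) hadd
  have hsub' := congrArg (fun y : ℝ => (y : ℂ)) hsub
  have hq'' := congrArg (fun y : ℝ => (y : ℂ)) hq'
  simp only [Complex.ofReal_add, Complex.ofReal_sub, Complex.ofReal_mul, Complex.ofReal_one]
    at hadd' hsub' hq''
  have hf' := Complex.re_add_im (f x)
  linear_combination ((f x).re : ℂ) * hadd' + (w x : ℂ) * Complex.I * hsub' + Complex.I * hq'' + hf'

variable [CompactSpace X]

/-- Fourier circuits in the variable `h` have outputs tending uniformly to `e^{ith²/2}`. This limit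
has modulus one, so normalization forces the other amplitude to zero and determines the limiting
operator. -/
theorem rzMap_sq_mem (hS : IsClosed (S : Set C(X, Op)))
    (hconst : ∀ M ∈ SU2, ContinuousMap.const X M ∈ S)
    {h : C(X, ℝ)} (hh : ∀ t : ℝ, rzMap (t • h) ∈ S) (t : ℝ) : rzMap (t • (h * h)) ∈ S := by
  set R : ℝ := ‖h‖ + 1 with hR
  have hR0 : 0 < R := by positivity
  set F : ℝ → ℂ := fun y => Complex.exp (Complex.I * ((t * (y * y) / 2 : ℝ) : ℂ)) with hF
  have hFn (y : ℝ) : ‖F y‖ = 1 := by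
    rw [hF]; simp only; rw [mul_comm, Complex.norm_exp_ofReal_mul_I]
  have hFc : Continuous F := by fun_prop
  -- `[-R, R]` contains the range of `h`, and `F` is even, so its endpoint values agree and
  -- convergence is uniform on the whole interval.
  obtain ⟨θ, -, -, -, hθ⟩ := exists_circuits_tendsto (P := 2 * R) (by positivity) (-R) 1 F ∅
    Set.finite_empty hFc.continuousOn fun y _ => (hFn y).le
  replace hθ := hθ hFc.continuousOn (by
    rw [show -R + 2 * R = R by ring, hF]
    simp only
    rw [neg_mul_neg])
  simp only [Complex.ofReal_one, one_mul] at hθ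
  choose g hg hgx using fun N => exists_mem_eq_fourierCircuit hconst hh (θ N)
  set p : ℕ → X → ℂ := fun N x => circuit fourierGate (θ N) (h x) 1 0 with hp
  set q : ℕ → X → ℂ := fun N x => -circuit fourierGate (θ N) (h x) 0 0 with hq
  have hmem (N x) := circuit_mem fourierGate (θ N) (h x) (S := SU2)
    fun i => fourierGate_mem_SU2 (h x) (θ N i)
  have hpu : TendstoUniformly p (fun x => F (h x)) atTop := by
    rw [Metric.tendstoUniformly_iff]
    intro ε hε
    filter_upwards [Metric.tendstoUniformlyOn_iff.1 hθ ε hε] with N hN x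
    have hx := abs_le.1 ((Real.norm_eq_abs _).symm.le.trans (h.norm_coe_le_norm x))
    have := hN (h x) ⟨by linarith, by linarith⟩
    rwa [output_eq] at this
  have hqu : TendstoUniformly q (fun _ => 0) atTop := by
    rw [Metric.tendstoUniformly_iff]
    intro ε hε
    filter_upwards [Metric.tendstoUniformly_iff.1 hpu (ε ^ 2 / 2) (by positivity)] with N hN x
    have h1 := norm_sq_col_of_mem_SU2 (hmem N x)
    have h2 := hN x
    rw [dist_eq_norm] at h2
    have h3 := norm_sub_norm_le (F (h x)) (p N x)
    rw [hFn] at h3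
    rw [dist_comm, dist_zero_right, hq, norm_neg]
    have h4 : ‖p N x‖ ^ 2 = 1 - ‖circuit fourierGate (θ N) (h x) 0 0‖ ^ 2 := by
      rw [← h1]; ring
    refine lt_of_pow_lt_pow_left₀ 2 hε.le ?_
    by_cases h5 : 1 - ε ^ 2 / 2 ≤ 0
    · nlinarith [sq_nonneg ‖p N x‖]
    · nlinarith [norm_nonneg (p N x)]
  -- `R_y(-π)` sends a column `(a, b)` to `(b, -a)`, moving the output amplitude onto the diagonal.
  have hlim : Tendsto (fun N => ContinuousMap.const X (Ry (-Real.pi)) * g N) atTop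
      (𝓝 (rzMap (t • (h * h)))) := by
    rw [ContinuousMap.tendsto_iff_tendstoUniformly]
    have hpq := uniformContinuous_colMatrix.comp_tendstoUniformly (hpu.prodMk hqu)
    have hdiag : Tendsto (fun N : ℕ => (N, N)) atTop (atTop ×ˢ atTop) :=
      tendsto_id.prodMk tendsto_id
    intro u hu
    filter_upwards [hdiag.eventually (hpq u hu)] with N hN x
    convert! hN x using 2
    · simp [Rz_eq_colMatrix, hF]
    · obtain ⟨a, b, -, hab⟩ := hmem N x
      simp only [ContinuousMap.mul_apply, ContinuousMap.const_apply, hgx, Function.comp, hp, hq,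
        hab, Ry_eq_colMatrix, colMatrix_mul]
      simp [colMatrix, neg_div]
  exact hS.mem_of_tendsto hlim (Eventually.of_forall fun N =>
    mul_mem (hconst _ (Ry_mem_SU2 _)) (hg N))

/-- The functions `h` all of whose multiples are available as angles of `z`-rotations. -/
def angleAlgebra (hS : IsClosed (S : Set C(X, Op)))
    (hconst : ∀ M ∈ SU2, ContinuousMap.const X M ∈ S) : Subalgebra ℝ C(X, ℝ) where
  carrier := {h | ∀ t : ℝ, rzMap (t • h) ∈ S}
  add_mem' := fun {h k} hh hk t => by
    rw [smul_add, rzMap_add]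
    exact mul_mem (hh t) (hk t)
  mul_mem' := fun {h k} hh hk t => by
    have hadd (t : ℝ) : rzMap (t • (h + k)) ∈ S := by
      rw [smul_add, rzMap_add]
      exact mul_mem (hh t) (hk t)
    -- Polarization: products are combinations of squares.
    have : t • (h * k) =
        (t / 2) • ((h + k) * (h + k)) + ((-t / 2) • (h * h) + (-t / 2) • (k * k)) := by
      ext x
      simp
      ring
    rw [this, rzMap_add, rzMap_add]
    exact mul_mem (rzMap_sq_mem hS hconst hadd _)
      (mul_mem (rzMap_sq_mem hS hconst hh _) (rzMap_sq_mem hS hconst hk _))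
  algebraMap_mem' := fun r t => hconst _ (Rz_mem_SU2 (t * r))

/-- Stone–Weierstrass makes the angle algebra dense; continuity of `rzMap` and closedness of `S` do
the rest. -/
theorem rzMap_mem (hS : IsClosed (S : Set C(X, Op)))
    (hconst : ∀ M ∈ SU2, ContinuousMap.const X M ∈ S)
    (hsep : ∀ x y : X, x ≠ y → ∃ h : C(X, ℝ), (∀ t : ℝ, rzMap (t • h) ∈ S) ∧ h x ≠ h y)
    (h : C(X, ℝ)) : rzMap h ∈ S := by
  have htop := ContinuousMap.subalgebra_topologicalClosure_eq_top_of_separatesPoints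
    (angleAlgebra hS hconst) fun x y hxy => by
      obtain ⟨h, hh, hne⟩ := hsep x y hxy
      exact ⟨h, ⟨h, hh, rfl⟩, hne⟩
  have hcl : h ∈ closure (angleAlgebra hS hconst : Set C(X, ℝ)) := by
    have : h ∈ (angleAlgebra hS hconst).topologicalClosure := by rw [htop]; trivial
    exact this
  refine hS.closure_subset_iff.2 ?_ (map_mem_closure continuous_rzMap hcl (t := S) ?_)
  · exact subset_rfl
  · intro k hk
    simpa using hk 1

end ClosedMonoid

/-! ### Approximation by UAT circuits -/

section UAT

variable {m : ℕ} {U : (Fin m → ℝ) → UATParams m → Op}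

theorem gate_eq_Rz (hU : U = uatGate ∨ U = uatGateZY) (ω : Fin m → ℝ) (α : ℝ) (x : Fin m → ℝ) :
    U x ⟨ω, α, 0⟩ = Rz (2 * (ω ⬝ᵥ x) + 2 * α) := by
  rcases hU with rfl | rfl
  · simp [uatGate]
  · simp [uatGateZY, mul_add]

theorem gate_eq_Ry (hU : U = uatGate ∨ U = uatGateZY) (φ : ℝ) (x : Fin m → ℝ) :
    U x ⟨0, 0, φ⟩ = Ry (2 * φ) := by
  rcases hU with rfl | rfl
  · simp [uatGate]
  · simp [uatGateZY]

/-- The continuous functions on the unit cube that are realized by circuits. -/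
def circuitMonoid (U : (Fin m → ℝ) → UATParams m → Op) :
    Submonoid C(Set.Icc (0 : Fin m → ℝ) 1, Op) where
  carrier := {g | ∃ (N : ℕ) (θ : Fin N → UATParams m), ∀ x, g x = circuit U θ x}
  one_mem' := ⟨0, Fin.elim0, fun x => by simp⟩
  mul_mem' := by
    rintro g h ⟨N, θ, hg⟩ ⟨N', θ', hh⟩
    exact ⟨N' + N, Fin.append θ' θ, fun x => by
      rw [circuit_append, ← hg, ← hh, ContinuousMap.mul_apply]⟩

theorem mem_circuitMonoid_of_gate {g : C(Set.Icc (0 : Fin m → ℝ) 1, Op)} (θ : UATParams m)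
    (h : ∀ x, g x = U x θ) : g ∈ circuitMonoid U :=
  ⟨1, fun _ => θ, fun x => by rw [circuit_succ, circuit_zero, mul_one, h]⟩

theorem const_mem_circuitMonoid (hU : U = uatGate ∨ U = uatGateZY) {M : Op} (hM : M ∈ SU2) :
    ContinuousMap.const _ M ∈ circuitMonoid U := by
  have hz (t : ℝ) : ContinuousMap.const _ (Rz t) ∈ circuitMonoid U :=
    mem_circuitMonoid_of_gate ⟨0, t / 2, 0⟩ fun x => by
      rw [gate_eq_Rz hU, zero_dotProduct, mul_zero, zero_add, mul_div_cancel₀ _ two_ne_zero]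
      rfl
  have hy (t : ℝ) : ContinuousMap.const _ (Ry (2 * t)) ∈ circuitMonoid U :=
    mem_circuitMonoid_of_gate ⟨0, 0, t⟩ fun x => by
      rw [gate_eq_Ry hU]
      rfl
  obtain ⟨α, β, lam, rfl⟩ := exists_euler hM
  have : ContinuousMap.const (Set.Icc (0 : Fin m → ℝ) 1)
      (Rz (α + β) * Ry (2 * lam) * Rz (α - β)) =
      .const _ (Rz (α + β)) * .const _ (Ry (2 * lam)) * .const _ (Rz (α - β)) :=
    ContinuousMap.ext fun _ => by simp
  rw [this]
  exact mul_mem (mul_mem (hz _) (hy _)) (hz _)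

/-- A gate with all parameters zero is the identity, so circuits can be padded. -/
theorem exists_circuit_eq_of_le (hU : U = uatGate ∨ U = uatGateZY) {N N' : ℕ} (hN : N ≤ N')
    (θ : Fin N → UATParams m) :
    ∃ θ' : Fin N' → UATParams m, ∀ x, circuit U θ' x = circuit U θ x := by
  induction N', hN using Nat.le_induction with
  | base => exact ⟨θ, fun _ => rfl⟩
  | succ N' _ ih =>
    obtain ⟨θ', h⟩ := ih
    exact ⟨Fin.snoc θ' ⟨0, 0, 0⟩, fun x => by
      rw [circuit_snoc, gate_eq_Ry hU, mul_zero, Ry_zero, one_mul, h]⟩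

theorem exists_uat_output_approx (hU : U = uatGate ∨ U = uatGateZY)
    (f : C(Set.Icc (0 : Fin m → ℝ) 1, ℂ)) (hf : ∀ x, ‖f x‖ ≤ 1) {ε : ℝ} (hε : 0 < ε) :
    ∃ N₀ : ℕ, ∀ N ≥ N₀, ∃ θ : Fin N → UATParams m,
      ∀ x : Set.Icc (0 : Fin m → ℝ) 1, ‖output U θ x - f x‖ < ε := by
  set S := (circuitMonoid U).topologicalClosure with hSdef
  have hle : circuitMonoid U ≤ S := Submonoid.le_topologicalClosure _
  have hS : IsClosed (S : Set C(Set.Icc (0 : Fin m → ℝ) 1, Op)) :=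
    Submonoid.isClosed_topologicalClosure _
  have hconst : ∀ M ∈ SU2, ContinuousMap.const _ M ∈ S := fun M hM =>
    hle (const_mem_circuitMonoid hU hM)
  have hz := rzMap_mem hS hconst fun x y hxy => by
    obtain ⟨i, hi⟩ := Function.ne_iff.1 (Subtype.coe_injective.ne hxy)
    refine ⟨⟨fun x => (x : Fin m → ℝ) i, (continuous_apply i).comp continuous_subtype_val⟩,
      fun t => hle ?_, hi⟩
    -- The coordinate functions separate points; the gate doubles `ω·x`, hence `t / 2`.
    refine mem_circuitMonoid_of_gate ⟨Pi.single i (t / 2), 0, 0⟩ fun x => ?_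
    rw [gate_eq_Rz hU, rzMap_apply]
    congr 1
    simp
    ring
  -- Shrinking `f` by `r` puts it strictly inside the unit disc at a cost of at most `ε / 2`; the
  -- minimum with `1` keeps `r ≥ 0`.
  set r : ℝ := 1 - min (ε / 2) 1 with hr
  have hε1 : 0 < min (ε / 2) 1 := lt_min (half_pos hε) one_pos
  have hr0 : 0 ≤ r := sub_nonneg.2 (min_le_right _ _)
  obtain ⟨g, hg, hgf⟩ := exists_mem_apply_one_zero_eq hconst hz ((r : ℂ) • f) (r := r)
    (by rw [hr]; linarith) fun x => by
      rw [ContinuousMap.smul_apply, norm_smul, Complex.norm_real, Real.norm_eq_abs,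
        abs_of_nonneg hr0]
      exact mul_le_of_le_one_right hr0 (hf x)
  set E : C(Set.Icc (0 : Fin m → ℝ) 1, Op) → C(Set.Icc (0 : Fin m → ℝ) 1, ℂ) :=
    ContinuousMap.comp ⟨fun M : Op => M 1 0, by fun_prop⟩ with hE
  have hEc : Continuous E := ContinuousMap.continuous_postcomp _
  have hmem : E g ∈ closure (E '' (circuitMonoid U : Set _)) :=
    image_closure_subset_closure_image hEc ⟨g, hg, rfl⟩
  obtain ⟨_, ⟨g', ⟨N₀, θ, hθ⟩, rfl⟩, hdist⟩ := Metric.mem_closure_iff.1 hmem (ε / 2) (half_pos hε)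
  refine ⟨N₀, fun N hN => ?_⟩
  obtain ⟨θ', hθ'⟩ := exists_circuit_eq_of_le hU hN θ
  refine ⟨θ', fun x => ?_⟩
  have h1 : ‖g' x 1 0 - g x 1 0‖ < ε / 2 := by
    rw [← dist_eq_norm, dist_comm]
    exact (ContinuousMap.dist_apply_le_dist (f := E g) (g := E g') x).trans_lt hdist
  have h2 : ‖g x 1 0 - f x‖ ≤ ε / 2 := by
    have : g x 1 0 - f x = -((min (ε / 2) 1 : ℝ) : ℂ) * f x := by
      rw [hgf, ContinuousMap.smul_apply, smul_eq_mul, hr, Complex.ofReal_sub, Complex.ofReal_one]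
      ring
    rw [this, norm_mul, norm_neg, Complex.norm_real, Real.norm_eq_abs, abs_of_pos hε1]
    exact (mul_le_of_le_one_right hε1.le (hf x)).trans (min_le_left _ _)
  rw [output_eq, hθ', ← hθ]
  have h3 := norm_add_le (g' x 1 0 - g x 1 0) (g x 1 0 - f x)
  rw [sub_add_sub_cancel] at h3
  linarith

theorem exists_uat_circuits_tendsto (hU : U = uatGate ∨ U = uatGateZY) (C : ℝ)
    (z : (Fin m → ℝ) → ℂ) (hz : ContinuousOn z (Set.Icc 0 1))
    (hC : ∀ x ∈ Set.Icc (0 : Fin m → ℝ) 1, ‖z x‖ ≤ C) :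
    ∃ θ : (N : ℕ) → Fin N → UATParams m,
      TendstoUniformlyOn (fun N x => (C : ℂ) * output U (θ N) x) z atTop (Set.Icc 0 1) := by
  have hC0 : 0 ≤ C := (norm_nonneg _).trans (hC 0 ⟨le_rfl, zero_le_one⟩)
  set f : C(Set.Icc (0 : Fin m → ℝ) 1, ℂ) :=
    ⟨fun x => (C : ℂ)⁻¹ * z x, continuous_const.mul
      (hz.comp_continuous continuous_subtype_val fun x => x.2)⟩ with hf
  have hCf (x : Set.Icc (0 : Fin m → ℝ) 1) : (C : ℂ) * f x = z x := by
    rcases eq_or_ne C 0 with h0 | h0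
    · have : z x = 0 := norm_le_zero_iff.1 (h0 ▸ hC x x.2)
      simp [hf, this]
    · rw [hf, ContinuousMap.coe_mk, mul_inv_cancel_left₀ (by exact_mod_cast h0)]
  have hf1 (x) : ‖f x‖ ≤ 1 := by
    rw [hf, ContinuousMap.coe_mk, norm_mul, norm_inv, Complex.norm_real, Real.norm_eq_abs,
      abs_of_nonneg hC0]
    exact (mul_le_mul_of_nonneg_left (hC x x.2) (inv_nonneg.2 hC0)).trans inv_mul_le_one
  choose d hd using fun n : ℕ => exists_uat_output_approx hU f hf1 (Nat.one_div_pos_of_nat (n := n))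
  obtain ⟨κ, hκ, hle⟩ := exists_tendsto_atTop_eventually_le d
  have hex (N : ℕ) : ∃ θ : Fin N → UATParams m, d (κ N) ≤ N →
      ∀ x : Set.Icc (0 : Fin m → ℝ) 1, ‖output U θ x - f x‖ < 1 / ((κ N : ℝ) + 1) := by
    by_cases hN : d (κ N) ≤ N
    · obtain ⟨θ, h⟩ := hd (κ N) N hN
      exact ⟨θ, fun _ => h⟩
    · exact ⟨fun _ => ⟨0, 0, 0⟩, fun h => absurd h hN⟩
  choose θ hθ using hex
  refine ⟨θ, ?_⟩
  rw [Metric.tendstoUniformlyOn_iff]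
  intro ε hε
  have hlim : Tendsto (fun N => C * (1 / ((κ N : ℝ) + 1))) atTop (𝓝 0) := by
    simpa using (tendsto_one_div_add_atTop_nhds_zero_nat.comp hκ).const_mul C
  filter_upwards [hle, hlim.eventually_lt_const hε] with N h1 h2 x hx
  rw [dist_comm, dist_eq_norm, ← hCf ⟨x, hx⟩, ← mul_sub, norm_mul, Complex.norm_real,
    Real.norm_eq_abs, abs_of_nonneg hC0]
  exact (mul_le_mul_of_nonneg_left (hθ N h1 ⟨x, hx⟩).le hC0).trans_lt h2

end UAT

end

end SingleQubit

theorem mainTheorem3 :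
    -- Fourier gates, one variable, any period `P`
    (∀ P : ℝ, 0 < P →
      -- the output is a truncated Fourier series
      (∀ (N L : ℕ) (θ : Fin L → FourierParams) (k : Fin L → ℤ),
        (∀ i, (θ i).ω = Real.pi * (k i : ℝ) / P) →
        Even (∑ i, k i) → ∑ i, |k i| ≤ 2 * (N : ℤ) →
        ∃ B : ℤ → ℂ, ∀ x : ℝ, output fourierGate θ x = fourierSum P N B x) ∧
      -- the coefficients are free, up to the normalisation of states
      (∀ (N : ℕ) (B : ℤ → ℂ),
        (∃ θ : Fin (2 * N + 1) → FourierParams,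
          (θ 0).ω = 0 ∧ (∀ i, i ≠ 0 → (θ i).ω = Real.pi / P) ∧
          ∀ x : ℝ, output fourierGate θ x = fourierSum P N B x) ↔
        ∀ x : ℝ, ‖fourierSum P N B x‖ ≤ 1) ∧
      -- convergence to bounded functions with finitely many discontinuities
      (∀ (a C : ℝ) (z : ℝ → ℂ) (D : Set ℝ), D.Finite →
        ContinuousOn z (Set.Ioo a (a + P) \ D) →
        (∀ x ∈ Set.Ico a (a + P), ‖z x‖ ≤ C) →
        ∃ θ : (N : ℕ) → Fin (2 * N + 1) → FourierParams,
          (∀ N, (θ N 0).ω = 0 ∧ ∀ i, i ≠ 0 → (θ N i).ω = Real.pi / P) ∧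
          (∀ x ∈ Set.Ico a (a + P),
            Tendsto (fun N => (C : ℂ) * output fourierGate (θ N) x) atTop (𝓝 (z x))) ∧
          (∀ K : Set ℝ, IsCompact K → K ⊆ Set.Ioo a (a + P) \ D →
            TendstoUniformlyOn (fun N x => (C : ℂ) * output fourierGate (θ N) x) z atTop K) ∧
          (ContinuousOn z (Set.Icc a (a + P)) → z a = z (a + P) →
            TendstoUniformlyOn (fun N x => (C : ℂ) * output fourierGate (θ N) x) z atTop
              (Set.Icc a (a + P))))) ∧
    -- UAT gates, any number of variables, with either order of the two rotations
    (∀ (m : ℕ) (U : (Fin m → ℝ) → UATParams m → Op), U = uatGate ∨ U = uatGateZY →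
      -- the output is a trigonometric sum with `2 ^ (N - 1)` terms
      (∀ N : ℕ, 1 ≤ N →
        ∃ (ε : Fin (2 ^ (N - 1)) → ℤˣ) (T : Fin (2 ^ (N - 1)) → Fin N → Bool)
          (s : Fin (2 ^ (N - 1)) → Fin N → ℤˣ),
          ∀ (θ : Fin N → UATParams m) (x : Fin m → ℝ),
            output U θ x = ∑ j,
              (((((ε j : ℤ) : ℝ) *
                ∏ n, if T j n then Real.sin (θ n).φ else Real.cos (θ n).φ) : ℝ) : ℂ) *
              Complex.exp (Complex.I * ((∑ n, ((s j n : ℤ) : ℝ) * (θ n).α : ℝ) : ℂ)) *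
              Complex.exp (Complex.I *
                (((∑ n, ((s j n : ℤ) : ℝ) • (θ n).ω) ⬝ᵥ x : ℝ) : ℂ))) ∧
      -- uniform convergence to continuous functions on the unit cube
      (∀ (C : ℝ) (z : (Fin m → ℝ) → ℂ), ContinuousOn z (Set.Icc 0 1) →
        (∀ x ∈ Set.Icc (0 : Fin m → ℝ) 1, ‖z x‖ ≤ C) →
        ∃ θ : (N : ℕ) → Fin N → UATParams m,
          TendstoUniformlyOn (fun N x => (C : ℂ) * output U (θ N) x) z atTop
            (Set.Icc 0 1))) := by
  refine ⟨fun P hP => ⟨fun N L θ k h he hN => exists_output_eq_fourierSum N L θ k h he hN,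
    fun N B => exists_output_eq_fourierSum_iff hP N B,
    fun a C z D hD hz hC => exists_circuits_tendsto hP a C z D hD hz hC⟩,
    fun m U hU => ⟨fun N hN => exists_output_eq_trigonometric_sum hU N hN,
      fun C z hz hC => exists_uat_circuits_tendsto hU C z hz hC⟩⟩
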